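/- Let $\Bbbk$ be a field, $W=\bigoplus_{d\in\mathbb Z}W_d$ a graded $\Bbbk$-vector space and $n\ge 1$. Let $\mathrm{Gr}(n)$ be the vector space with basis the connected acyclic graphs with vertex set $\{1,\dots,n\}$ and oriented edges. Let $\mathrm{Eil}(n)$ be its quotient by the arrow-reversing relations $G+G'=0$ ($G'$ is $G$ with one edge reversed) and the Arnold relations $G_1+G_2+G_3=0$ (the $G_i$ have the same edges except that $G_1$ has $a\to b\to c$, $G_2$ has $b\to c\to a$ and $G_3$ has $c\to a\to b$). Let $$\mathbb E^nW=\bigl(\mathrm{Eil}(n)\otimes W^{\otimes n}\bigr)_{\Sigma_n},$$ where $\Sigma_n$ relabels vertices and permutes tensor factors with Koszul signs; this is the weight $n$ part of the graph model of the cofree Lie coalgebra on $W$. The bar generator $w_1|\cdots|w_n\in\mathbb E^nW$ is the class of the long graph $1\to2\to\cdots\to n$ tensored with $w_1\otimes\cdots\otimes w_n$. For homogeneous $w_i$ and $\tau\in\Sigma_n$ let $\varepsilon(\tau;w)=\pm1$ be the Koszul sign of the reordering of $w_1\cdots w_n$ into $w_{\tau(1)}\cdots w_{\tau(n)}$. Let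 $\mathrm{Sh}_k\subset\Sigma_n$ be the set of $\tau$ for which $\tau(1)=k$ and $(\tau(2),\dots,\tau(n))$ is a shuffle of $(k-1,k-2,\dots,1)$ into $(k+1,\dots,n)$. Then: 1. The bar generators span $\mathbb E^nW$, and the relations $$w_1|w_2|\cdots|w_n+(-1)^k\sum_{\tau\in\mathrm{Sh}_k}\varepsilon(\tau;w)\;w_k|w_{\tau(2)}|\cdots|w_{\tau(n)}=0\qquad(1\le k\le n,\ w_i\text{ homogeneous})$$ hold and are a spanning set of all relations among them: the kernel of the linear map $W^{\otimes n}\to\mathbb E^nW$, $w_1\otimes\cdots\otimes w_n\mapsto w_1|\cdots|w_n$, is the span of the elements $w_1\otimes\cdots\otimes w_n+(-1)^k\sum_{\tau\in\mathrm{Sh}_k}\varepsilon(\tau;w)\,w_{\tau(1)}\otimes\cdots\otimes w_{\tau(n)}$. Equivalently, each bar generator is expressed in those that begin with its $k$-th letter: $w_1|\cdots|w_n=(-1)^{k-1}\sum_{\tau\in\mathrm{Sh}_k}\varepsilon(\tau;w)\,w_{\tau(1)}|\cdots|w_{\tau(n)}$. 2. For every permutation $(j_1,\dots,j_n)$ of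 $\{1,\dots,n\}$ and every $k$, the long graphs satisfy in $\mathrm{Eil}(n)$ $$[j_1\to\cdots\to j_n]=(-1)^{k-1}\sum_{\tau\in\mathrm{Sh}_k}[j_{\tau(1)}\to\cdots\to j_{\tau(n)}],$$ and for every vertex $a$ the long graphs that begin with $a$ form a basis of $\mathrm{Eil}(n)$. 3. Let $(b_i)_{i\in I}$ be a basis of $W$ of homogeneous elements and $i_0\in I$. The bar generators $b_{i_0}|b_{i_2}|\cdots|b_{i_n}$ with $i_2,\dots,i_n\ne i_0$ form a basis of the subspace of $\mathbb E^nW$ spanned by the bar generators $b_{i_1}|\cdots|b_{i_n}$ in which $b_{i_0}$ occurs exactly once. -/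

import Mathlib

open scoped TensorProduct

noncomputable section

namespace LieCoalg

/-! ### Oriented graphs and the quotient `Eil` -/

/-- An `S`-graph: a connected, acyclic graph with vertex set `S`, each of whose edges carries an
orientation.  The element `(a, b)` of `edges` is an edge pointing from `a` to `b`. -/
@[ext]
structure SGraph (S : Type*) where
  edges : Set (S × S)
  oriented : ∀ a b, (a, b) ∈ edges → (b, a) ∉ edges
  isTree : (SimpleGraph.fromRel fun a b => (a, b) ∈ edges).IsTree

/-- `Gr(n)`: the vector space freely generated by the graphs with vertex set `Fin n`. -/
abbrev Gr (𝕜 : Type*) [Field 𝕜] (n : ℕ) : Type _ := SGraph (Fin n) →₀ 𝕜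

/-- The basis vector of `Gr(n)` given by a graph. -/
def Gr.of (𝕜 : Type*) [Field 𝕜] {n : ℕ} (G : SGraph (Fin n)) : Gr 𝕜 n := Finsupp.single G 1

/-- Arrow-reversing expressions: `G + G'`, where `G` has an edge from `a` to `b` and `G'` is `G`
with this edge reversed.  The set `R` of the remaining edges does not contain this edge in either
direction, because graphs are oriented. -/
inductive ArrowReversing (𝕜 : Type*) [Field 𝕜] {n : ℕ} : Gr 𝕜 n → Prop
  | intro (G G' : SGraph (Fin n)) (a b : Fin n) (R : Set (Fin n × Fin n))
      (hG : G.edges = insert (a, b) R) (hG' : G'.edges = insert (b, a) R) :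
      ArrowReversing 𝕜 (Gr.of 𝕜 G + Gr.of 𝕜 G')

/-- Arnold expressions: the sum of three graphs which share a set `R` of edges and whose other
edges are `a → b → c`, `b → c → a` and `c → a → b`, respectively.  Since the graphs are oriented
and acyclic, `a, b, c` are distinct and no edge between two of them is in `R`. -/
inductive Arnold (𝕜 : Type*) [Field 𝕜] {n : ℕ} : Gr 𝕜 n → Prop
  | intro (G₁ G₂ G₃ : SGraph (Fin n)) (a b c : Fin n) (R : Set (Fin n × Fin n))
      (h₁ : G₁.edges = insert (a, b) (insert (b, c) R))
      (h₂ : G₂.edges = insert (b, c) (insert (c, a) R))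
      (h₃ : G₃.edges = insert (c, a) (insert (a, b) R)) :
      Arnold 𝕜 (Gr.of 𝕜 G₁ + Gr.of 𝕜 G₂ + Gr.of 𝕜 G₃)

/-- The subspace of `Gr(n)` spanned by arrow-reversing and Arnold expressions. -/
def arn (𝕜 : Type*) [Field 𝕜] (n : ℕ) : Submodule 𝕜 (Gr 𝕜 n) :=
  Submodule.span 𝕜 {x | ArrowReversing 𝕜 x ∨ Arnold 𝕜 x}

/-- `Eil(n)`: the quotient of `Gr(n)` by the arrow-reversing and Arnold relations. -/
abbrev Eil (𝕜 : Type*) [Field 𝕜] (n : ℕ) : Type _ := Gr 𝕜 n ⧸ arn 𝕜 n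

/-! ### Relabelling and long graphs -/

theorem fromRel_relabel_isTree {S : Type*} (σ : Equiv.Perm S) (G : SGraph S) :
    (SimpleGraph.fromRel fun a b => (a, b) ∈ {p : S × S | (σ.symm p.1, σ.symm p.2) ∈ G.edges}).IsTree := by
  refine (SimpleGraph.Iso.isTree_iff ⟨σ, ?_⟩).mp G.isTree
  intro a b
  simp

/-- The action of permutations on graphs: the vertex `a` is renamed to `σ a`. -/
def SGraph.relabel {S : Type*} (σ : Equiv.Perm S) (G : SGraph S) : SGraph S where
  edges := {p | (σ.symm p.1, σ.symm p.2) ∈ G.edges}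
  oriented := fun a b h => G.oriented (σ.symm a) (σ.symm b) h
  isTree := fromRel_relabel_isTree σ G

theorem path_isTree (n : ℕ) [NeZero n] :
    (SimpleGraph.fromRel fun a b : Fin n =>
      (a, b) ∈ {p : Fin n × Fin n | p.1.val + 1 = p.2.val}).IsTree := by
  obtain ⟨m, rfl⟩ := Nat.exists_eq_succ_of_ne_zero (NeZero.ne n)
  have key : (SimpleGraph.fromRel fun a b : Fin (m + 1) =>
      (a, b) ∈ {p : Fin (m + 1) × Fin (m + 1) | p.1.val + 1 = p.2.val}) =
      SimpleGraph.pathGraph (m + 1) := by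
    ext a b
    simp only [SimpleGraph.fromRel_adj, Set.mem_ofPred_eq, SimpleGraph.pathGraph_adj, ne_eq,
      Fin.ext_iff]
    omega
  rw [Nat.succ_eq_add_one, key, SimpleGraph.isTree_iff_connected_and_card]
  refine ⟨SimpleGraph.pathGraph_connected m, ?_⟩
  have himg : (SimpleGraph.pathGraph (m + 1)).edgeSet =
      Set.range fun i : Fin m => s(i.castSucc, i.succ) := by
    ext e
    induction e using Sym2.ind with
    | _ a b =>
      simp only [SimpleGraph.mem_edgeSet, SimpleGraph.pathGraph_adj, Set.mem_range, Sym2.eq,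
        Sym2.rel_iff', Prod.mk.injEq, Prod.swap_prod_mk, Fin.ext_iff, Fin.val_castSucc,
        Fin.val_succ]
      constructor
      · rintro (h | h)
        · exact ⟨⟨a, by omega⟩, Or.inl ⟨rfl, h⟩⟩
        · exact ⟨⟨b, by omega⟩, Or.inr ⟨rfl, h⟩⟩
      · rintro ⟨i, h⟩
        omega
  have hinj : Function.Injective fun i : Fin m => s(i.castSucc, i.succ) := by
    intro i j h
    simp only [Sym2.eq, Sym2.rel_iff', Prod.mk.injEq, Prod.swap_prod_mk, Fin.ext_iff,
      Fin.val_castSucc, Fin.val_succ] at h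
    ext
    omega
  rw [himg, Nat.card_range_of_injective hinj]
  simp

/-- The standard long graph `0 → 1 → ⋯ → n - 1`. -/
def stdLong (n : ℕ) [NeZero n] : SGraph (Fin n) where
  edges := {p | p.1.val + 1 = p.2.val}
  oriented := by
    intro a b h h'
    simp only [Set.mem_ofPred_eq] at h h'
    omega
  isTree := path_isTree n

/-- The long graph `τ 0 → τ 1 → ⋯ → τ (n - 1)`. -/
def longGraph {n : ℕ} [NeZero n] (τ : Equiv.Perm (Fin n)) : SGraph (Fin n) :=
  (stdLong n).relabel τ

/-- The class of a long graph in `Eil(n)`. -/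
def longClass (𝕜 : Type*) [Field 𝕜] {n : ℕ} [NeZero n] (τ : Equiv.Perm (Fin n)) : Eil 𝕜 n :=
  (arn 𝕜 n).mkQ (Gr.of 𝕜 (longGraph τ))

/-! ### Koszul signs and the weight `n` part of the cofree Lie coalgebra -/

/-- The Koszul sign of the reordering of `w₀ ⊗ ⋯ ⊗ wₙ₋₁` into `w_{τ 0} ⊗ ⋯ ⊗ w_{τ (n-1)}`, where
`wᵢ` is homogeneous of degree `d i`: a factor `(-1)^{|x||y|}` for each two letters `x, y` whose
order is changed. -/
def koszulSign {n : ℕ} (d : Fin n → ℤ) (τ : Equiv.Perm (Fin n)) : ℤˣ :=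
  ∏ p : Fin n × Fin n with p.1 < p.2 ∧ τ p.2 < τ p.1, (d (τ p.1) * d (τ p.2)).negOnePow

section

variable (𝕜 : Type*) [Field 𝕜] {W : Type*} [AddCommGroup W] [Module 𝕜 W]
  (𝒲 : ℤ → Submodule 𝕜 W) (n : ℕ)

/-- The tensor product of `W^{⊗ n}` and `Gr(n)`, in this order; `Gr(n)` is in degree zero, so the
order of the factors is immaterial.  In `(w₀ ⊗ ⋯ ⊗ wₙ₋₁) ⊗ G` the vertex `i` of `G` carries the
label `wᵢ`. -/
abbrev LabelledGr (𝕜 : Type*) [Field 𝕜] (W : Type*) [AddCommGroup W] [Module 𝕜 W] (n : ℕ) :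
    Type _ :=
  (⨂[𝕜] _ : Fin n, W) ⊗[𝕜] Gr 𝕜 n

/-- The subspace whose quotient is the coinvariants for the diagonal action of the symmetric
group, where permutations act on tensors of homogeneous elements with Koszul signs. -/
def symRel : Submodule 𝕜 (LabelledGr 𝕜 W n) :=
  Submodule.span 𝕜
    {x | ∃ (G : SGraph (Fin n)) (τ : Equiv.Perm (Fin n)) (d : Fin n → ℤ) (w : Fin n → W),
      (∀ i, w i ∈ 𝒲 (d i)) ∧
      x = PiTensorProduct.tprod 𝕜 w ⊗ₜ[𝕜] Gr.of 𝕜 (G.relabel τ) -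
        koszulSign d τ • (PiTensorProduct.tprod 𝕜 (w ∘ τ) ⊗ₜ[𝕜] Gr.of 𝕜 G)}

/-- The subspace generated by labelled arrow-reversing and Arnold expressions. -/
def arnRel (𝕜 : Type*) [Field 𝕜] (W : Type*) [AddCommGroup W] [Module 𝕜 W] (n : ℕ) :
    Submodule 𝕜 (LabelledGr 𝕜 W n) :=
  Submodule.span 𝕜
    {x | ∃ g ∈ arn 𝕜 n, ∃ t : ⨂[𝕜] _ : Fin n, W, x = t ⊗ₜ[𝕜] g}

/-- `𝔼ⁿ W`: the quotient of `W^{⊗ n} ⊗ Gr(n)` by the action of the symmetric group and by the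
arrow-reversing and Arnold relations. -/
abbrev E : Type _ := LabelledGr 𝕜 W n ⧸ (symRel 𝕜 𝒲 n ⊔ arnRel 𝕜 W n)

/-- The linear map `W^{⊗ n} → 𝔼ⁿ W` which sends `w₀ ⊗ ⋯ ⊗ wₙ₋₁` to the bar generator
`w₀|⋯|wₙ₋₁`, the class of the long graph `0 → 1 → ⋯ → n - 1` labelled by `w₀, …, wₙ₋₁`. -/
def barMap [NeZero n] : (⨂[𝕜] _ : Fin n, W) →ₗ[𝕜] E 𝕜 𝒲 n :=
  (symRel 𝕜 𝒲 n ⊔ arnRel 𝕜 W n).mkQ ∘ₗ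
    (TensorProduct.mk 𝕜 (⨂[𝕜] _ : Fin n, W) (Gr 𝕜 n)).flip (Gr.of 𝕜 (stdLong n))

variable {n}

/-- The bar generator `w₀|⋯|wₙ₋₁` of `𝔼ⁿ W`. -/
def bar [NeZero n] (w : Fin n → W) : E 𝕜 𝒲 n := barMap 𝕜 𝒲 n (PiTensorProduct.tprod 𝕜 w)

end

/-! ### Shuffles -/

/-- The permutations `τ` for which the sequence `τ 0, τ 1, …, τ (n - 1)` consists of `k` followed
by a shuffle of `(k - 1, k - 2, …, 0)` into `(k + 1, …, n - 1)`: the entries smaller than `k` occur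
in decreasing order, and those larger than `k` in increasing order (`τ.symm a` is the position of
the entry `a`). -/
def shuffles {n : ℕ} [NeZero n] (k : Fin n) : Finset (Equiv.Perm (Fin n)) :=
  {τ | τ 0 = k ∧ (∀ a b, a < b → b < k → τ.symm b < τ.symm a) ∧
    (∀ a b, k < a → a < b → τ.symm a < τ.symm b)}

/-- The element
`w₀ ⊗ ⋯ ⊗ wₙ₋₁ + (-1)^(k+1) ∑ ± w_k ⊗ w_{σ 0} ⊗ ⋯ ⊗ w_{σ (n-2)}` of `W^{⊗ n}`, the sum being over
the shuffles `σ` of `(k - 1, …, 0)` into `(k + 1, …, n - 1)`, with Koszul signs for homogeneous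
`wᵢ` of degree `d i`.  The exponent is `k + 1` because letters are numbered from `0` here. -/
def shuffleRelator (𝕜 : Type*) [Field 𝕜] {W : Type*} [AddCommGroup W] [Module 𝕜 W] {n : ℕ}
    [NeZero n] (k : Fin n) (d : Fin n → ℤ) (w : Fin n → W) : ⨂[𝕜] _ : Fin n, W :=
  PiTensorProduct.tprod 𝕜 w + (-1 : ℤˣ) ^ (k.val + 1) •
    ∑ τ ∈ shuffles k, koszulSign d τ • PiTensorProduct.tprod 𝕜 (w ∘ τ)

end LieCoalg

end

/-! Each permutation `σ`, read as the word `σ 0, σ 1, …`, gives a linear form on graphs. It is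
nonzero on a tree exactly when every vertex other than `σ 0` has a single neighbour earlier in the
word, that is, when the word is a linear extension of the tree rooted at `σ 0`; its value is then
`-1` to the number of edges that point backward. These forms kill the arrow-reversing and Arnold
expressions (`treeCoeff_reverse`, `treeCoeff_arnold`), so they live on `Eil(n)`. On a path they are
nonzero iff the positions of its vertices fall until the root and rise after it, which is the
shuffle condition (`treeCoeff_stdLong`).

A path read from its own first vertex admits one linear extension. Hence the forms with `σ 0 = a`
are dual to the long graphs that begin with `a`, which are therefore independent. They span because
Arnold replaces a fork in a tree rooted at `a` by two chains, up to sign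
(`graphClass_isParent_mem`). Expanding a long graph in this dual basis, with its vertex in position
`k` as root, gives the shuffle formula; labelling by tensors gives the relations among bar
generators.

That there are no further relations is shown by a map back. Send `t ⊗ G` to the sum over `σ 0 = 0`
of the value of `σ` on `G` times the signed permutation of `t` by `σ`, modulo shuffle relators.
Modulo these the choice of root is immaterial (`mkQ_sum_pairing_smul`), so the map respects
relabelling and descends to `𝔼ⁿ W`; on a bar generator it returns the class of the original tensor
(`ker_barMap`).

For a letter that occurs once, the shuffle formula moves it to the front. Independence follows from
the sum over all `σ`, with no root fixed, which maps `𝔼ⁿ W` to `W^{⊗ n}` itself: among words that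
begin with this letter and contain it once, only the identity contributes (`linearIndependent_bar`).
-/

noncomputable section

namespace LieCoalg

/-! ### The pairing of graphs with permutations -/

/-- The endpoint of `e` which comes later in the sequence `σ 0, σ 1, …`. -/
def laterEnd {n : ℕ} (σ : Equiv.Perm (Fin n)) (e : Fin n × Fin n) : Fin n :=
  if σ.symm e.1 < σ.symm e.2 then e.2 else e.1

/-- The sign of an edge: `1` if it points forward in the sequence `σ 0, σ 1, …`, and `-1`
otherwise. -/
def edgeSign {n : ℕ} (σ : Equiv.Perm (Fin n)) (e : Fin n × Fin n) : ℤ :=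
  if σ.symm e.1 < σ.symm e.2 then 1 else -1

open Classical in
/-- The product of the signs of the edges in `E`. -/
def edgeSignProd {n : ℕ} (σ : Equiv.Perm (Fin n)) (E : Set (Fin n × Fin n)) : ℤ :=
  ∏ e with e ∈ E, edgeSign σ e

open Classical in
/-- The product of the signs of the edges if no vertex is the later end of two edges, and `0`
otherwise. For a tree this is, up to sign, the indicator of the linear extensions of the tree
rooted at `σ 0`. -/
def treeCoeff {n : ℕ} (σ : Equiv.Perm (Fin n)) (E : Set (Fin n × Fin n)) : ℤ :=
  if Set.InjOn (laterEnd σ) E then edgeSignProd σ E else 0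

theorem edgeSignProd_insert {n : ℕ} (σ : Equiv.Perm (Fin n)) {e : Fin n × Fin n}
    {R : Set (Fin n × Fin n)} (he : e ∉ R) :
    edgeSignProd σ (insert e R) = edgeSign σ e * edgeSignProd σ R := by
  classical
  unfold edgeSignProd
  rw [← Finset.prod_insert (by simpa using he)]
  congr 1
  ext x
  simp

theorem laterEnd_swap {n : ℕ} (σ : Equiv.Perm (Fin n)) (a b : Fin n) :
    laterEnd σ (b, a) = laterEnd σ (a, b) := by
  unfold laterEnd
  rcases lt_trichotomy (σ.symm a) (σ.symm b) with h | h | h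
  · simp [h, h.not_gt]
  · simp [σ.symm.injective h]
  · simp [h, h.not_gt]

theorem edgeSign_swap {n : ℕ} (σ : Equiv.Perm (Fin n)) {a b : Fin n} (hab : a ≠ b) :
    edgeSign σ (b, a) = - edgeSign σ (a, b) := by
  unfold edgeSign
  rcases lt_trichotomy (σ.symm a) (σ.symm b) with h | h | h
  · simp [h, h.not_gt]
  · exact absurd (σ.symm.injective h) hab
  · simp [h, h.not_gt]

theorem SGraph.ne_of_mem {S : Type*} (G : SGraph S) {a b : S} (h : (a, b) ∈ G.edges) : a ≠ b := by
  rintro rfl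
  exact G.oriented _ _ h h

theorem SGraph.not_triangle {S : Type*} (G : SGraph S) {a b c : S} (hab : (a, b) ∈ G.edges)
    (hbc : (b, c) ∈ G.edges) (hca : (c, a) ∈ G.edges) : False := by
  have h1 := G.ne_of_mem hab
  have h2 := G.ne_of_mem hbc
  have h3 := G.ne_of_mem hca
  have adj : ∀ {x y : S}, (x, y) ∈ G.edges →
      (SimpleGraph.fromRel fun a b => (a, b) ∈ G.edges).Adj x y := fun h => by
    simp [h, G.ne_of_mem h]
  refine G.isTree.isAcyclic (.cons (adj hab) (.cons (adj hbc) (.cons (adj hca) .nil))) ?_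
  rw [SimpleGraph.Walk.cons_isCycle_iff]
  simp [h1, h1.symm, h2, h3, h3.symm]

theorem treeCoeff_reverse {n : ℕ} (σ : Equiv.Perm (Fin n)) {a b : Fin n}
    {R : Set (Fin n × Fin n)} (hne : a ≠ b) (hab : (a, b) ∉ R) (hba : (b, a) ∉ R) :
    treeCoeff σ (insert (a, b) R) + treeCoeff σ (insert (b, a) R) = 0 := by
  unfold treeCoeff
  rw [edgeSignProd_insert σ hab, edgeSignProd_insert σ hba, Set.injOn_insert hab,
    Set.injOn_insert hba, laterEnd_swap σ a b, edgeSign_swap σ hne]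
  split_ifs <;> ring

/-- With `a` first in the word, the edges `ab` and `ca` have later ends `b` and `c`, and the edge
`bc` has the later of the two. One of the three graphs then has two edges with the same later end
and contributes `0`; the other two have the same later ends and opposite signs. The general case
follows by the cyclic symmetry of the expression. -/
theorem treeCoeff_arnold_of_lt {n : ℕ} (σ : Equiv.Perm (Fin n)) {a b c : Fin n}
    {R : Set (Fin n × Fin n)} (hab : (a, b) ∉ R) (hbc : (b, c) ∉ R) (hca : (c, a) ∉ R)
    (h1 : σ.symm a < σ.symm b) (h2 : σ.symm a < σ.symm c) (h3 : b ≠ c) :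
    treeCoeff σ (insert (a, b) (insert (b, c) R)) +
      treeCoeff σ (insert (b, c) (insert (c, a) R)) +
      treeCoeff σ (insert (c, a) (insert (a, b) R)) = 0 := by
  have nab : a ≠ b := fun h => by simp [h] at h1
  have nac : a ≠ c := fun h => by simp [h] at h2
  have e1 : (a, b) ∉ insert (b, c) R := by simp [nab, hab]
  have e2 : (b, c) ∉ insert (c, a) R := by simp [h3, hbc]
  have e3 : (c, a) ∉ insert (a, b) R := by simp [nac.symm, hca]
  unfold treeCoeff
  rw [edgeSignProd_insert σ e1, edgeSignProd_insert σ e2, edgeSignProd_insert σ e3,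
    edgeSignProd_insert σ hab, edgeSignProd_insert σ hbc, edgeSignProd_insert σ hca,
    Set.injOn_insert e1, Set.injOn_insert e2, Set.injOn_insert e3,
    Set.injOn_insert hab, Set.injOn_insert hbc, Set.injOn_insert hca,
    Set.image_insert_eq, Set.image_insert_eq, Set.image_insert_eq]
  have ne : σ.symm b ≠ σ.symm c := fun h => h3 (σ.symm.injective h)
  rcases ne.lt_or_gt with h | h
  · have l1 : laterEnd σ (a, b) = b := by simp [laterEnd, h1]
    have l2 : laterEnd σ (b, c) = c := by simp [laterEnd, h]
    have l3 : laterEnd σ (c, a) = c := by simp [laterEnd, h2.not_gt]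
    have s1 : edgeSign σ (a, b) = 1 := by simp [edgeSign, h1]
    have s2 : edgeSign σ (b, c) = 1 := by simp [edgeSign, h]
    have s3 : edgeSign σ (c, a) = -1 := by simp [edgeSign, h2.not_gt]
    simp only [s1, s2, s3]
    split_ifs <;> first | ring1 | (exfalso; grind)
  · have l1 : laterEnd σ (a, b) = b := by simp [laterEnd, h1]
    have l2 : laterEnd σ (b, c) = b := by simp [laterEnd, h.not_gt]
    have l3 : laterEnd σ (c, a) = c := by simp [laterEnd, h2.not_gt]
    have s1 : edgeSign σ (a, b) = 1 := by simp [edgeSign, h1]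
    have s2 : edgeSign σ (b, c) = -1 := by simp [edgeSign, h.not_gt]
    have s3 : edgeSign σ (c, a) = -1 := by simp [edgeSign, h2.not_gt]
    simp only [s1, s2, s3]
    split_ifs <;> first | ring1 | (exfalso; grind)

theorem treeCoeff_arnold {n : ℕ} (σ : Equiv.Perm (Fin n)) {a b c : Fin n}
    {R : Set (Fin n × Fin n)} (hab : (a, b) ∉ R) (hbc : (b, c) ∉ R) (hca : (c, a) ∉ R)
    (nab : a ≠ b) (nbc : b ≠ c) (nca : c ≠ a) :
    treeCoeff σ (insert (a, b) (insert (b, c) R)) +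
      treeCoeff σ (insert (b, c) (insert (c, a) R)) +
      treeCoeff σ (insert (c, a) (insert (a, b) R)) = 0 := by
  have ne : ∀ {x y}, x ≠ y → σ.symm x ≠ σ.symm y := fun h h' => h (σ.symm.injective h')
  rcases (ne nab).lt_or_gt with h1 | h1
  · rcases (ne nca).lt_or_gt with h2 | h2
    · have := treeCoeff_arnold_of_lt σ hca hab hbc h2 (h2.trans h1) nab
      linarith
    · exact treeCoeff_arnold_of_lt σ hab hbc hca h1 h2 nbc
  · rcases (ne nbc).lt_or_gt with h2 | h2
    · have := treeCoeff_arnold_of_lt σ hbc hca hab h2 h1 nca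
      linarith
    · have := treeCoeff_arnold_of_lt σ hca hab hbc (h2.trans h1) h2 nab
      linarith

/-- The linear form on `Gr(n)` with values `treeCoeff σ` on graphs. -/
def grPairing (𝕜 : Type*) [Field 𝕜] {n : ℕ} (σ : Equiv.Perm (Fin n)) : Gr 𝕜 n →ₗ[𝕜] 𝕜 :=
  Finsupp.linearCombination 𝕜 fun G : SGraph (Fin n) => (treeCoeff σ G.edges : 𝕜)

@[simp]
theorem grPairing_of (𝕜 : Type*) [Field 𝕜] {n : ℕ} (σ : Equiv.Perm (Fin n))
    (G : SGraph (Fin n)) : grPairing 𝕜 σ (Gr.of 𝕜 G) = (treeCoeff σ G.edges : 𝕜) := by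
  simp [grPairing, Gr.of]

theorem arn_le_ker_grPairing (𝕜 : Type*) [Field 𝕜] {n : ℕ} (σ : Equiv.Perm (Fin n)) :
    arn 𝕜 n ≤ LinearMap.ker (grPairing 𝕜 σ) := by
  refine Submodule.span_le.mpr ?_
  rintro x (⟨G, G', a, b, R, hG, hG'⟩ | ⟨G₁, G₂, G₃, a, b, c, R, h₁, h₂, h₃⟩)
  · have m : (a, b) ∈ G.edges := by simp [hG]
    have m' : (b, a) ∈ G'.edges := by simp [hG']
    have hab : (a, b) ∉ R := fun h => G'.oriented _ _ m' (by simp [hG', h])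
    have hba : (b, a) ∉ R := fun h => G.oriented _ _ m (by simp [hG, h])
    have := treeCoeff_reverse σ (G.ne_of_mem m) hab hba
    simp only [SetLike.mem_coe, LinearMap.mem_ker, map_add, grPairing_of, hG, hG']
    simpa using congrArg (Int.cast (R := 𝕜)) this
  · have m1 : (a, b) ∈ G₁.edges := by simp [h₁]
    have m2 : (b, c) ∈ G₂.edges := by simp [h₂]
    have m3 : (c, a) ∈ G₃.edges := by simp [h₃]
    have hab : (a, b) ∉ R := fun h => G₂.not_triangle (a := a) (b := b) (c := c)
      (by simp [h₂, h]) (by simp [h₂]) (by simp [h₂])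
    have hbc : (b, c) ∉ R := fun h => G₃.not_triangle (a := a) (b := b) (c := c)
      (by simp [h₃]) (by simp [h₃, h]) (by simp [h₃])
    have hca : (c, a) ∉ R := fun h => G₁.not_triangle (a := a) (b := b) (c := c)
      (by simp [h₁]) (by simp [h₁]) (by simp [h₁, h])
    have := treeCoeff_arnold σ hab hbc hca (G₁.ne_of_mem m1) (G₂.ne_of_mem m2) (G₃.ne_of_mem m3)
    simp only [SetLike.mem_coe, LinearMap.mem_ker, map_add, grPairing_of, h₁, h₂, h₃]
    simpa using congrArg (Int.cast (R := 𝕜)) this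

/-- The linear form on `Eil(n)` with values `treeCoeff σ` on graphs. -/
def pairing (𝕜 : Type*) [Field 𝕜] {n : ℕ} (σ : Equiv.Perm (Fin n)) : Eil 𝕜 n →ₗ[𝕜] 𝕜 :=
  (arn 𝕜 n).liftQ (grPairing 𝕜 σ) (arn_le_ker_grPairing 𝕜 σ)

@[simp]
theorem pairing_mkQ (𝕜 : Type*) [Field 𝕜] {n : ℕ} (σ : Equiv.Perm (Fin n)) (x : Gr 𝕜 n) :
    pairing 𝕜 σ ((arn 𝕜 n).mkQ x) = grPairing 𝕜 σ x := by
  simp [pairing]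

theorem treeCoeff_relabel {n : ℕ} (σ τ : Equiv.Perm (Fin n)) (G : SGraph (Fin n)) :
    treeCoeff (τ * σ) (G.relabel τ).edges = treeCoeff σ G.edges := by
  have hl : ∀ e : Fin n × Fin n, laterEnd (τ * σ) (τ e.1, τ e.2) = τ (laterEnd σ e) := by
    intro e
    simp only [laterEnd, Equiv.Perm.mul_def, Equiv.symm_trans_apply, Equiv.symm_apply_apply]
    split_ifs <;> rfl
  have hs : ∀ e : Fin n × Fin n, edgeSign (τ * σ) (τ e.1, τ e.2) = edgeSign σ e := by
    intro e
    simp [edgeSign, Equiv.Perm.mul_def]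
  have hE : (G.relabel τ).edges = (fun e : Fin n × Fin n => (τ e.1, τ e.2)) '' G.edges := by
    ext ⟨x, y⟩
    simp only [SGraph.relabel, Set.mem_ofPred_eq, Set.mem_image, Prod.mk.injEq, Prod.exists]
    constructor
    · exact fun h => ⟨_, _, h, by simp, by simp⟩
    · rintro ⟨a, b, h, rfl, rfl⟩
      simpa using h
  have hinj : Function.Injective (fun e : Fin n × Fin n => (τ e.1, τ e.2)) := by
    rintro ⟨a, b⟩ ⟨a', b'⟩ h
    simpa using h
  unfold treeCoeff
  congr 1
  · rw [hE]
    refine propext ⟨fun h e he e' he' heq => ?_, ?_⟩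
    · exact hinj (h ⟨e, he, rfl⟩ ⟨e', he', rfl⟩ (by simp only [hl, heq]))
    · rintro h _ ⟨e, he, rfl⟩ _ ⟨e', he', rfl⟩ heq
      simp only [hl] at heq
      rw [h he he' (τ.injective heq)]
  · rw [hE]
    symm
    unfold edgeSignProd
    refine Finset.prod_bij (fun e _ => (τ e.1, τ e.2)) ?_ ?_ ?_ ?_
    · intro e he
      simp only [Finset.mem_filter, Finset.mem_univ, true_and] at he ⊢
      exact ⟨e, he, rfl⟩
    · intro e _ e' _ h
      exact hinj h
    · intro e he
      simp only [Finset.mem_filter, Finset.mem_univ, true_and] at he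
      obtain ⟨e', h, rfl⟩ := he
      exact ⟨e', by simpa using h, rfl⟩
    · intro e _
      exact (hs e).symm

/-! ### The pairing on long graphs -/

theorem mem_shuffles {n : ℕ} [NeZero n] {k : Fin n} {τ : Equiv.Perm (Fin n)} :
    τ ∈ shuffles k ↔ τ 0 = k ∧ (∀ a b, a < b → b < k → τ.symm b < τ.symm a) ∧
      (∀ a b, k < a → a < b → τ.symm a < τ.symm b) := by
  simp [shuffles]

theorem shuffles_zero {n : ℕ} [NeZero n] : shuffles (0 : Fin n) = {1} := by
  ext τ
  rw [mem_shuffles, Finset.mem_singleton]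
  constructor
  · rintro ⟨h0, -, h⟩
    have h0' : τ.symm 0 = 0 := by rw [Equiv.symm_apply_eq, h0]
    have hm : StrictMono τ.symm := by
      intro a b hab
      rcases eq_or_ne a 0 with rfl | ha
      · rw [h0']
        refine Fin.pos_iff_ne_zero.mpr fun hb => hab.ne' ?_
        rw [← h0'] at hb
        exact τ.symm.injective hb
      · exact h a b (Fin.pos_iff_ne_zero.mpr ha) hab
    have : τ.symm = 1 := by
      ext x
      have := Subsingleton.elim (hm.orderIsoOfSurjective _ τ.symm.surjective) (OrderIso.refl _)
      have := congrArg (fun f => f x) this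
      simpa using congrArg Fin.val this
    rw [← Equiv.symm_symm τ, this]
    rfl
  · rintro rfl
    exact ⟨rfl, fun a b _ h => absurd h (Fin.not_lt_zero b), fun a b _ h => h⟩

theorem mem_stdLong {n : ℕ} [NeZero n] {x y : Fin n} :
    (x, y) ∈ (stdLong n).edges ↔ x.val + 1 = y.val := Iff.rfl

theorem symm_lt_symm_iff_of_mem_shuffles {n : ℕ} [NeZero n] {k : Fin n} {σ : Equiv.Perm (Fin n)}
    (hσ : σ ∈ shuffles k) {x y : Fin n} (hxy : (x, y) ∈ (stdLong n).edges) :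
    σ.symm x < σ.symm y ↔ k ≤ x := by
  obtain ⟨h0, hdec, hinc⟩ := mem_shuffles.mp hσ
  have hk : σ.symm k = 0 := by rw [Equiv.symm_apply_eq, h0]
  rw [mem_stdLong] at hxy
  have hlt : x < y := by omega
  have hpos : ∀ z, z ≠ k → 0 < σ.symm z := fun z hz =>
    Fin.pos_iff_ne_zero.mpr fun h => hz (σ.symm.injective (h.trans hk.symm))
  rcases lt_trichotomy x k with h | h | h
  · refine iff_of_false (not_lt_of_gt ?_) h.not_ge
    rcases (show y ≤ k by omega).lt_or_eq with h' | h'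
    · exact hdec x y hlt h'
    · rw [h', hk]
      exact hpos x h.ne
  · refine iff_of_true ?_ h.ge
    rw [h, hk]
    exact hpos y (h ▸ hlt.ne')
  · exact iff_of_true (hinc x y h hlt) h.le

/-- Without interior peaks a sequence of distinct values keeps rising once it has risen, so it must
fall all the way to its minimum, at `k`, and rise from there. -/
theorem lt_of_no_peak {n k : ℕ} {q : ℕ → ℕ} (hq : ∀ i j, q i = q j → i = j)
    (hk : q k = 0) (hpeak : ∀ i, i + 2 < n → q i < q (i + 1) → q (i + 1) < q (i + 2)) (hkn : k < n) :
    (∀ a b, a < b → b ≤ k → q b < q a) ∧ (∀ a b, k ≤ a → a < b → b < n → q a < q b) := by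
  have hne : ∀ i j, i ≠ j → q i ≠ q j := fun i j h h' => h (hq i j h')
  have hdec : ∀ j i, i + 1 + j = k → q (i + 1) < q i := by
    intro j
    induction j with
    | zero =>
      rintro i rfl
      have := hne i (i + 1) (by omega)
      simp only [add_zero] at hk
      omega
    | succ j ih =>
      intro i hi
      have h1 := ih (i + 1) (by omega)
      have h2 := hpeak i (by omega)
      have h3 := hne i (i + 1) (by omega)
      have : i + 1 + 1 = i + 2 := rfl
      rw [this] at h1
      omega
  have hinc : ∀ i, k ≤ i → i + 1 < n → q i < q (i + 1) := by
    intro i hi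
    induction i, hi using Nat.le_induction with
    | base =>
      intro _
      have := hne k (k + 1) (by omega)
      omega
    | succ i hi ih =>
      intro h
      exact hpeak i h (ih (by omega))
  constructor
  · intro a b hab
    induction b, hab using Nat.le_induction with
    | base => exact fun h => hdec (k - (a + 1)) a (by omega)
    | succ b hb ih => exact fun h => (hdec (k - (b + 1)) b (by omega)).trans (ih (by omega))
  · intro a b ha hab
    induction b, hab using Nat.le_induction with
    | base => exact fun h => hinc a ha h
    | succ b hb ih => exact fun h => (ih (by omega)).trans (hinc b (by omega) h)

/-- Two edges of a path can share their later end only if they are adjacent, and then the common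
vertex is a peak of the positions `σ.symm`. -/
theorem injOn_laterEnd_stdLong {n : ℕ} [NeZero n] {k : Fin n} {σ : Equiv.Perm (Fin n)}
    (hk : σ 0 = k) : Set.InjOn (laterEnd σ) (stdLong n).edges ↔ σ ∈ shuffles k := by
  constructor
  · intro h
    -- Outside `Fin n` the positions are continued by the identity, which keeps `q` injective on all
    -- of `ℕ`.
    let q : ℕ → ℕ := fun i => if hi : i < n then (σ.symm ⟨i, hi⟩).val else i
    have hqv : ∀ x : Fin n, q x.val = (σ.symm x).val := fun x => by simp [q]
    have hq : ∀ i j, q i = q j → i = j := by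
      intro i j hij
      simp only [q] at hij
      split_ifs at hij with h1 h2 h2
      · simpa using σ.symm.injective (Fin.ext hij)
      · omega
      · omega
      · exact hij
    have hk0 : q k.val = 0 := by
      rw [hqv, show σ.symm k = 0 by rw [Equiv.symm_apply_eq, hk]]
      rfl
    have hpeak : ∀ i, i + 2 < n → q i < q (i + 1) → q (i + 1) < q (i + 2) := by
      intro i hi h1
      by_contra h2
      have h3 : q (i + 1) ≠ q (i + 2) := fun h' => by have := hq _ _ h'; omega
      have := @h (⟨i, by omega⟩, ⟨i + 1, by omega⟩) (mem_stdLong.mpr rfl)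
        (⟨i + 1, by omega⟩, ⟨i + 2, hi⟩) (mem_stdLong.mpr rfl) ?_
      · simp at this
      · simp only [q, show i < n by omega, show i + 1 < n by omega, hi, dite_true] at h1 h2
        simp [laterEnd, Fin.lt_def, h1, h2]
    obtain ⟨h1, h2⟩ := lt_of_no_peak hq hk0 hpeak k.isLt
    refine mem_shuffles.mpr ⟨hk, fun a b hab hb => ?_, fun a b ha hab => ?_⟩
    · have := h1 a b hab (le_of_lt hb)
      rwa [hqv, hqv] at this
    · have := h2 a b (le_of_lt ha) hab b.isLt
      rwa [hqv, hqv] at this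
  · rintro h ⟨x, y⟩ hxy ⟨x', y'⟩ hxy' heq
    simp only [laterEnd, symm_lt_symm_iff_of_mem_shuffles h hxy,
      symm_lt_symm_iff_of_mem_shuffles h hxy'] at heq
    rw [mem_stdLong] at hxy hxy'
    rw [Prod.mk.injEq]
    split_ifs at heq <;> omega

theorem treeCoeff_stdLong {n : ℕ} [NeZero n] {k : Fin n} {σ : Equiv.Perm (Fin n)}
    (hk : σ 0 = k) :
    treeCoeff σ (stdLong n).edges = if σ ∈ shuffles k then (-1) ^ k.val else 0 := by
  unfold treeCoeff
  simp only [injOn_laterEnd_stdLong hk]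
  split_ifs with h
  · classical
    have : ∀ e ∈ Finset.univ.filter (· ∈ (stdLong n).edges),
        edgeSign σ e = if e.1 < k then -1 else 1 := by
      rintro ⟨x, y⟩ he
      simp only [Finset.mem_filter, Finset.mem_univ, true_and] at he
      simp only [edgeSign, symm_lt_symm_iff_of_mem_shuffles h he, ← not_le, ite_not]
    unfold edgeSignProd
    rw [Finset.prod_congr (by congr) this, Finset.prod_ite, Finset.prod_const, Finset.prod_const_one,
      mul_one]
    congr 1
    -- The backward edges are those that start at a vertex below `k`, one for each such vertex.
    rw [← Fin.card_Iio k]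
    refine Finset.card_bij (fun e _ => e.1) ?_ ?_ ?_
    · intro e he
      simpa using (Finset.mem_filter.mp he).2
    · rintro ⟨x, y⟩ he ⟨x', y'⟩ he' (heq : x = x')
      simp only [Finset.mem_filter, Finset.mem_univ, true_and, mem_stdLong] at he he'
      rw [Prod.mk.injEq]
      omega
    · intro x hx
      rw [Finset.mem_Iio] at hx
      refine ⟨(x, ⟨x.val + 1, by omega⟩), ?_, rfl⟩
      simp [mem_stdLong, hx]
  · rfl

theorem pairing_longClass (𝕜 : Type*) [Field 𝕜] {n : ℕ} [NeZero n] (τ σ : Equiv.Perm (Fin n)) :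
    pairing 𝕜 (τ * σ) (longClass 𝕜 τ) = if σ ∈ shuffles (σ 0) then (-1) ^ (σ 0).val else 0 := by
  rw [longClass, pairing_mkQ, grPairing_of, longGraph, treeCoeff_relabel, treeCoeff_stdLong rfl]
  split_ifs <;> simp

/-- The permutation `τ⁻¹ * σ` fixes `0`, and the only shuffle for `k = 0` is the identity. This is
the duality behind both independence and the coordinate formula. -/
theorem pairing_longClass_of_apply_zero_eq (𝕜 : Type*) [Field 𝕜] {n : ℕ} [NeZero n]
    {τ σ : Equiv.Perm (Fin n)} (h : τ 0 = σ 0) :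
    pairing 𝕜 σ (longClass 𝕜 τ) = if σ = τ then 1 else 0 := by
  have := pairing_longClass 𝕜 τ (τ⁻¹ * σ)
  have h0 : (τ⁻¹ * σ) 0 = 0 := by simp [← h]
  rw [mul_inv_cancel_left, h0, shuffles_zero] at this
  rw [this]
  simp [inv_mul_eq_one, eq_comm]

theorem linearIndependent_longClass (𝕜 : Type*) [Field 𝕜] {n : ℕ} [NeZero n] (a : Fin n) :
    LinearIndependent 𝕜
      (fun j : {j : Equiv.Perm (Fin n) // j 0 = a} => longClass 𝕜 j.1) := by
  rw [linearIndependent_iff']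
  intro s g hg i hi
  have := congrArg (pairing 𝕜 i.1) hg
  rw [map_sum, map_zero, Finset.sum_eq_single_of_mem i hi] at this
  · simpa [pairing_longClass_of_apply_zero_eq] using this
  · intro j _ hj
    rw [map_smul, pairing_longClass_of_apply_zero_eq 𝕜 (j.2.trans i.2.symm),
      if_neg fun h => hj (Subtype.ext h.symm), smul_zero]

section Graphs

/-! ### Graphs with the same underlying tree -/

/-- The underlying unoriented tree of a graph. -/
def SGraph.toSimple {S : Type*} (G : SGraph S) : SimpleGraph S :=
  SimpleGraph.fromRel fun a b => (a, b) ∈ G.edges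

theorem SGraph.toSimple_adj {S : Type*} (G : SGraph S) {a b : S} :
    G.toSimple.Adj a b ↔ (a, b) ∈ G.edges ∨ (b, a) ∈ G.edges := by
  simp only [SGraph.toSimple, SimpleGraph.fromRel_adj]
  refine ⟨And.right, fun h => ⟨?_, h⟩⟩
  rcases h with h | h
  · exact G.ne_of_mem h
  · exact (G.ne_of_mem h).symm

/-- Another orientation of the tree underlying `G`. -/
def SGraph.reorient {S : Type*} (G : SGraph S) (E : Set (S × S))
    (hE : ∀ a b, (a, b) ∈ E → (b, a) ∉ E)
    (h : ∀ a b, ((a, b) ∈ E ∨ (b, a) ∈ E) ↔ ((a, b) ∈ G.edges ∨ (b, a) ∈ G.edges)) :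
    SGraph S where
  edges := E
  oriented := hE
  isTree := by
    have := G.isTree
    convert this using 1
    ext a b
    simp [h]

theorem SGraph.toSimple_reorient {S : Type*} (G : SGraph S) (E : Set (S × S)) (hE) (h) :
    (G.reorient E hE h).toSimple = G.toSimple := by
  ext a b
  simp only [SGraph.toSimple_adj]
  exact h a b

theorem SGraph.eq_of_subset {S : Type*} {G G' : SGraph S} (h : G.toSimple = G'.toSimple)
    (hs : G.edges ⊆ G'.edges) : G = G' := by
  ext ⟨a, b⟩
  refine ⟨fun h => hs h, fun hab => ?_⟩
  have : G.toSimple.Adj a b := h ▸ G'.toSimple_adj.mpr (.inl hab)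
  rcases G.toSimple_adj.mp this with h' | h'
  · exact h'
  · exact absurd (hs h') (G'.oriented _ _ hab)

variable (𝕜 : Type*) [Field 𝕜] {n : ℕ}

/-- The class of a graph in `Eil(n)`. -/
def graphClass (G : SGraph (Fin n)) : Eil 𝕜 n := (arn 𝕜 n).mkQ (Gr.of 𝕜 G)

theorem graphClass_add_reverse {G G' : SGraph (Fin n)} {a b : Fin n} {R : Set (Fin n × Fin n)}
    (hG : G.edges = insert (a, b) R) (hG' : G'.edges = insert (b, a) R) :
    graphClass 𝕜 G + graphClass 𝕜 G' = 0 := by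
  rw [graphClass, graphClass, ← map_add]
  exact (Submodule.Quotient.mk_eq_zero _).mpr
    (Submodule.subset_span (.inl ⟨G, G', a, b, R, hG, hG'⟩))

theorem graphClass_arnold {G₁ G₂ G₃ : SGraph (Fin n)} {a b c : Fin n} {R : Set (Fin n × Fin n)}
    (h₁ : G₁.edges = insert (a, b) (insert (b, c) R))
    (h₂ : G₂.edges = insert (b, c) (insert (c, a) R))
    (h₃ : G₃.edges = insert (c, a) (insert (a, b) R)) :
    graphClass 𝕜 G₁ + graphClass 𝕜 G₂ + graphClass 𝕜 G₃ = 0 := by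
  rw [graphClass, graphClass, graphClass, ← map_add, ← map_add]
  exact (Submodule.Quotient.mk_eq_zero _).mpr
    (Submodule.subset_span (.inr ⟨G₁, G₂, G₃, a, b, c, R, h₁, h₂, h₃⟩))

/-- Two orientations of one tree differ by finitely many reversals, each of which changes only the
sign; the induction is on the number of edges oriented differently. -/
theorem graphClass_mem_of_toSimple_eq {S : Submodule 𝕜 (Eil 𝕜 n)} {G G' : SGraph (Fin n)}
    (h : G.toSimple = G'.toSimple) (hG' : graphClass 𝕜 G' ∈ S) : graphClass 𝕜 G ∈ S := by
  induction hm : (G.edges \ G'.edges).ncard using Nat.strong_induction_on generalizing G with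
  | _ m ih =>
  by_cases hs : G.edges ⊆ G'.edges
  · rwa [SGraph.eq_of_subset h hs]
  · obtain ⟨⟨a, b⟩, hab, hab'⟩ := Set.not_subset.mp hs
    have hba : (b, a) ∈ G'.edges :=
      (G'.toSimple_adj.mp (h ▸ G.toSimple_adj.mpr (.inl hab))).resolve_left hab'
    have hba' := G.oriented _ _ hab
    have hne := G.ne_of_mem hab
    have ho := G.oriented
    let G₁ := G.reorient (insert (b, a) (G.edges \ {(a, b)})) (by grind) (by grind)
    have h₁ : graphClass 𝕜 G₁ ∈ S := by
      refine ih _ ?_ ((G.toSimple_reorient _ _ _).trans h) rfl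
      rw [← hm]
      refine Set.ncard_lt_ncard ?_ (Set.toFinite _)
      refine (Set.ssubset_iff_of_subset ?_).mpr ⟨(a, b), ⟨hab, hab'⟩, ?_⟩
      · rintro e ⟨he | he, he'⟩
        · exact absurd (he ▸ hba) he'
        · exact ⟨he.1, he'⟩
      · rintro ⟨he | he, -⟩
        · exact hne (congrArg Prod.fst he)
        · exact he.2 rfl
    have := graphClass_add_reverse 𝕜 (G := G) (G' := G₁) (a := a) (b := b)
      (R := G.edges \ {(a, b)}) (by grind) rfl
    rw [add_eq_zero_iff_eq_neg.mp this]
    exact S.neg_mem h₁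

/-! ### Rooted trees given by parent functions -/

/-- `par` sends every vertex other than `a` to its parent in a tree with root `a`. -/
structure IsParent {V : Type*} (a : V) (par : V → V) : Prop where
  root : par a = a
  reach : ∀ v, ∃ k : ℕ, par^[k] v = a

namespace IsParent

variable {V : Type*} {a : V} {par : V → V}

theorem exists_depth (h : IsParent a par) :
    ∃ d : V → ℕ, d a = 0 ∧ ∀ v, v ≠ a → d v = d (par v) + 1 := by
  classical
  refine ⟨fun v => Nat.find (h.reach v), by simp, fun v hv => ?_⟩
  obtain ⟨k, hk⟩ : ∃ k, Nat.find (h.reach v) = k + 1 := by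
    refine Nat.exists_eq_succ_of_ne_zero fun h0 => hv ?_
    simpa using (Nat.find_eq_zero _).mp h0
  have spec := Nat.find_spec (h.reach v)
  rw [hk, Function.iterate_succ_apply] at spec
  refine le_antisymm ?_ ?_
  · refine Nat.find_min' _ ?_
    rw [Function.iterate_succ_apply]
    exact Nat.find_spec (h.reach (par v))
  · simp only [hk, Nat.add_le_add_iff_right]
    exact Nat.find_min' _ spec

theorem ne_of_iterate (h : IsParent a par) {v : V} (hv : v ≠ a) (k : ℕ) : par^[k] (par v) ≠ v := by
  obtain ⟨d, hda, hd⟩ := h.exists_depth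
  have hle : ∀ w, d (par w) ≤ d w := fun w => by
    by_cases hw : w = a
    · rw [hw, h.root]
    · rw [hd w hw]
      omega
  have hit : ∀ k w, d (par^[k] w) ≤ d w := by
    intro k
    induction k with
    | zero => exact fun w => le_rfl
    | succ k ih => exact fun w => (ih (par w)).trans (hle w)
  intro heq
  have := hit k (par v)
  rw [heq, hd v hv] at this
  omega

theorem ne (h : IsParent a par) {v : V} (hv : v ≠ a) : par v ≠ v := h.ne_of_iterate hv 0

/-- Every vertex is joined to the root, and the edges are indexed by the vertices other than the
root, so there are too few of them for a cycle. -/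
theorem fromRel_isTree [Finite V] (h : IsParent a par) :
    (SimpleGraph.fromRel fun x y => (x, y) ∈ {p : V × V | p.2 ≠ a ∧ par p.2 = p.1}).IsTree := by
  have hreach : ∀ k v, par^[k] v = a → (SimpleGraph.fromRel fun x y =>
      (x, y) ∈ {p : V × V | p.2 ≠ a ∧ par p.2 = p.1}).Reachable v a := by
    intro k
    induction k with
    | zero =>
      rintro v rfl
      exact .refl _
    | succ k ih =>
      intro v hv
      by_cases hva : v = a
      · rw [hva]
      · refine .trans (SimpleGraph.Adj.reachable ?_) (ih (par v) hv)
        simp [hva, (h.ne hva).symm]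
  have hconn : (SimpleGraph.fromRel fun x y =>
      (x, y) ∈ {p : V × V | p.2 ≠ a ∧ par p.2 = p.1}).Connected := by
    have : Nonempty V := ⟨a⟩
    refine ⟨fun u v => ?_⟩
    obtain ⟨k, hk⟩ := h.reach u
    obtain ⟨l, hl⟩ := h.reach v
    exact (hreach k u hk).trans (hreach l v hl).symm
  rw [SimpleGraph.isTree_iff_connected_and_card]
  refine ⟨hconn, le_antisymm ?_ hconn.card_vert_le_card_edgeSet_add_one⟩
  have hsub : (SimpleGraph.fromRel fun x y =>
      (x, y) ∈ {p : V × V | p.2 ≠ a ∧ par p.2 = p.1}).edgeSet ⊆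
      (fun v => s(par v, v)) '' {a}ᶜ := by
    intro e
    induction e using Sym2.ind with
    | _ x y =>
    simp only [SimpleGraph.mem_edgeSet, SimpleGraph.fromRel_adj, Set.mem_ofPred_eq]
    rintro ⟨-, ⟨h1, h2⟩ | ⟨h1, h2⟩⟩
    · exact ⟨y, h1, by simp [h2]⟩
    · exact ⟨x, h1, by simp [h2]⟩
  have h1 := Set.ncard_le_ncard hsub (Set.toFinite _)
  have h2 := Set.ncard_image_le (f := fun v => s(par v, v)) (Set.toFinite ({a}ᶜ : Set V))
  have h3 := Set.ncard_add_ncard_compl ({a} : Set V)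
  rw [Set.ncard_singleton] at h3
  rw [Nat.card_coe_set_eq]
  omega

/-- The tree of a parent function, with all edges pointing away from the root. -/
def graph [Finite V] (h : IsParent a par) : SGraph V where
  edges := {p | p.2 ≠ a ∧ par p.2 = p.1}
  oriented := by
    rintro x y ⟨h1, h2⟩ ⟨h3, h4⟩
    refine h.ne_of_iterate h3 1 ?_
    simp_all
  isTree := h.fromRel_isTree

theorem mem_graph [Finite V] (h : IsParent a par) {x y : V} :
    (x, y) ∈ h.graph.edges ↔ y ≠ a ∧ par y = x := Iff.rfl

-- Reattaching `y` below its sibling `x` only lengthens paths to the root: a step from `y` to its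
-- parent becomes the detour through `x`.
open Classical in
theorem iterate_update {x y : V} (hxy : x ≠ y) (hp : par x = par y) (u : V) (k : ℕ) :
    ∃ l, (Function.update par y x)^[l] u = par^[k] u := by
  induction k with
  | zero => exact ⟨0, rfl⟩
  | succ k ih =>
    obtain ⟨l, hl⟩ := ih
    rw [Function.iterate_succ_apply', ← hl]
    by_cases hz : (Function.update par y x)^[l] u = y
    · refine ⟨l + 2, ?_⟩
      rw [Function.iterate_succ_apply', Function.iterate_succ_apply', hz]
      simp [hxy, hp]
    · refine ⟨l + 1, ?_⟩
      rw [Function.iterate_succ_apply', Function.update_of_ne hz]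

open Classical in
theorem update (h : IsParent a par) {x y : V} (hy : y ≠ a) (hxy : x ≠ y) (hp : par x = par y) :
    IsParent a (Function.update par y x) where
  root := by rw [Function.update_of_ne hy.symm, h.root]
  reach v := by
    obtain ⟨k, hk⟩ := h.reach v
    obtain ⟨l, hl⟩ := iterate_update hxy hp v k
    exact ⟨l, hl.trans hk⟩

-- The pair `(y, x)` is new, since siblings are not ancestors of each other. The growth of the
-- ancestor relation makes the removal of forks terminate.
open Classical in
theorem ancestors_ssubset (h : IsParent a par) {x y : V} (hx : x ≠ a) (hxy : x ≠ y)
    (hp : par x = par y) :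
    {p : V × V | ∃ k, par^[k] p.1 = p.2} ⊂
      {p : V × V | ∃ k, (Function.update par y x)^[k] p.1 = p.2} := by
  refine (Set.ssubset_iff_of_subset ?_).mpr ⟨(y, x), ⟨1, by simp⟩, ?_⟩
  · rintro ⟨u, w⟩ ⟨k, hk⟩
    obtain ⟨l, hl⟩ := iterate_update hxy hp u k
    exact ⟨l, hl.trans hk⟩
  · rintro ⟨_ | k, hk⟩
    · exact hxy hk.symm
    · simp only [Function.iterate_succ_apply, ← hp] at hk
      exact h.ne_of_iterate hx k hk

/-- Without forks there is at most one vertex at each depth, and the depths fill an initial segment,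
so depth numbers the vertices along the path. -/
theorem exists_longGraph_eq [NeZero n] {a : Fin n} {par : Fin n → Fin n} (h : IsParent a par)
    (hinj : ∀ x y, x ≠ a → y ≠ a → par x = par y → x = y) :
    ∃ σ : Equiv.Perm (Fin n), σ 0 = a ∧ h.graph = longGraph σ := by
  obtain ⟨d, hda, hd⟩ := h.exists_depth
  have hd0 : ∀ v, d v = 0 → v = a := fun v hv => by
    by_contra hva
    have := hd v hva
    omega
  have dinj : ∀ m u v, d u = m → d v = m → u = v := by
    intro m
    induction m with
    | zero => exact fun u v hu hv => (hd0 u hu).trans (hd0 v hv).symm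
    | succ m ih =>
      intro u v hu hv
      have hua : u ≠ a := by rintro rfl; omega
      have hva : v ≠ a := by rintro rfl; omega
      have := hd u hua
      have := hd v hva
      exact hinj u v hua hva (ih _ _ (by omega) (by omega))
  have ddown : ∀ m v, d v = m → ∀ i ≤ m, ∃ u, d u = i := by
    intro m
    induction m with
    | zero => exact fun v hv i hi => ⟨v, by omega⟩
    | succ m ih =>
      intro v hv i hi
      have hva : v ≠ a := by rintro rfl; omega
      have := hd v hva
      rcases hi.lt_or_eq with hi | hi
      · exact ih (par v) (by omega) i (by omega)
      · exact ⟨v, by omega⟩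
  have dlt : ∀ v, d v < n := by
    intro v
    have hsub : Finset.range (d v + 1) ⊆ Finset.univ.image d := by
      intro i hi
      obtain ⟨u, hu⟩ := ddown _ v rfl i (by simpa [Nat.lt_succ_iff] using hi)
      exact Finset.mem_image.mpr ⟨u, Finset.mem_univ _, hu⟩
    have h1 := Finset.card_le_card hsub
    have h2 := Finset.card_image_le (s := (Finset.univ : Finset (Fin n))) (f := d)
    simp only [Finset.card_range, Finset.card_univ, Fintype.card_fin] at h1 h2
    omega
  have hbij : Function.Bijective fun v => (⟨d v, dlt v⟩ : Fin n) :=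
    Finite.injective_iff_bijective.mp fun u v huv => dinj _ u v rfl (congrArg Fin.val huv).symm
  refine ⟨(Equiv.ofBijective _ hbij).symm, ?_, ?_⟩
  · rw [Equiv.symm_apply_eq]
    ext
    simp [hda]
  · ext ⟨x, y⟩
    change (y ≠ a ∧ par y = x) ↔ d x + 1 = d y
    constructor
    · rintro ⟨hy, rfl⟩
      exact (hd y hy).symm
    · intro hxy
      have hy : y ≠ a := by rintro rfl; omega
      have := hd y hy
      exact ⟨hy, dinj _ _ _ rfl (by omega)⟩

/-- The parent of a vertex is a neighbour closer to `a`. The resulting tree is a connected subgraph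
of the given one, and a tree is minimal among connected graphs. -/
theorem exists_of_sGraph [Finite V] (G : SGraph V) (a : V) :
    ∃ (par : V → V) (h : IsParent a par), h.graph.toSimple = G.toSimple := by
  classical
  have hG : G.toSimple.IsTree := G.isTree
  have hnext : ∀ v, v ≠ a → ∃ w, G.toSimple.Adj v w ∧ G.toSimple.dist w a < G.toSimple.dist v a := by
    intro v hv
    obtain ⟨p, hp⟩ := hG.connected.exists_walk_length_eq_dist v a
    cases p with
    | nil => exact absurd rfl hv
    | cons hadj q =>
      refine ⟨_, hadj, ?_⟩
      rw [← hp, SimpleGraph.Walk.length_cons]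
      exact Nat.lt_succ_of_le (SimpleGraph.dist_le q)
  choose! next hadj hlt using hnext
  have hpar : IsParent a fun v => if v = a then a else next v := by
    refine ⟨by simp, fun v => ?_⟩
    induction hm : G.toSimple.dist v a using Nat.strong_induction_on generalizing v with
    | _ m ih =>
    by_cases hv : v = a
    · exact ⟨0, hv⟩
    · obtain ⟨k, hk⟩ := ih _ (hm ▸ hlt v hv) (next v) rfl
      exact ⟨k + 1, by simpa [hv] using hk⟩
  refine ⟨_, hpar, ?_⟩
  have hle : hpar.graph.toSimple ≤ G.toSimple := by
    intro x y hxy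
    rcases hpar.graph.toSimple_adj.mp hxy with h | h
    · obtain ⟨h1, h2⟩ := hpar.mem_graph.mp h
      rw [if_neg h1] at h2
      exact h2 ▸ (hadj y h1).symm
    · obtain ⟨h1, h2⟩ := hpar.mem_graph.mp h
      rw [if_neg h1] at h2
      exact h2 ▸ hadj x h1
  have hT : hpar.graph.toSimple.IsTree := hpar.graph.isTree
  exact le_antisymm hle
    ((SimpleGraph.isTree_iff_minimal_connected.mp hG).2 hT.connected hle)

end IsParent

/-! ### Long graphs span `Eil(n)` -/

theorem oriented_insert_insert {V : Type*} {R : Set (V × V)} {x y z : V}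
    (hR : ∀ u w, (u, w) ∈ R → (w, u) ∉ R) (hxy : x ≠ y) (hyz : y ≠ z) (hxz : x ≠ z)
    (h₁ : (y, x) ∉ R) (h₂ : (z, y) ∉ R) (u w : V)
    (h : (u, w) ∈ insert (x, y) (insert (y, z) R)) :
    (w, u) ∉ insert (x, y) (insert (y, z) R) := by
  simp only [Set.mem_insert_iff, Prod.mk.injEq] at h ⊢
  grind

/-- Up to signs, Arnold replaces a fork of two children `x`, `y` of one vertex by the two trees in
which one sibling is moved below the other. Both have more ancestor pairs, so induction on the
number of non-ancestor pairs ends at trees without forks, which are long graphs. -/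
theorem graphClass_isParent_mem [NeZero n] {a : Fin n} {S : Submodule 𝕜 (Eil 𝕜 n)}
    (hS : ∀ σ : Equiv.Perm (Fin n), σ 0 = a → longClass 𝕜 σ ∈ S)
    {par : Fin n → Fin n} (h : IsParent a par) : graphClass 𝕜 h.graph ∈ S := by
  induction hm : ({p : Fin n × Fin n | ∃ k, par^[k] p.1 = p.2}ᶜ).ncard
    using Nat.strong_induction_on generalizing par with
  | _ m ih =>
  by_cases hinj : ∀ x y, x ≠ a → y ≠ a → par x = par y → x = y
  · obtain ⟨σ, h0, hσ⟩ := h.exists_longGraph_eq hinj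
    rw [hσ]
    exact hS σ h0
  · push Not at hinj
    obtain ⟨x, y, hx, hy, hp, hxy⟩ := hinj
    have step : ∀ {x y}, x ≠ a → ∀ (hy : y ≠ a) (hp : par x = par y) (hxy : x ≠ y),
        graphClass 𝕜 (h.update hy hxy hp).graph ∈ S := by
      intro x y hx hy hp hxy
      refine ih _ ?_ (h.update hy hxy hp) rfl
      rw [← hm]
      exact Set.ncard_lt_ncard (compl_lt_compl_iff_lt.mpr (h.ancestors_ssubset hx hxy hp))
        (Set.toFinite _)
    have h1 := step hx hy hp hxy
    have h2 := step hy hx hp.symm hxy.symm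
    have hvx : par x ≠ x := h.ne hx
    have hvy : par x ≠ y := hp ▸ h.ne hy
    set R : Set (Fin n × Fin n) := {p | p.2 ≠ a ∧ p.2 ≠ x ∧ p.2 ≠ y ∧ par p.2 = p.1} with hR
    have e0 : h.graph.edges = insert (par x, x) (insert (par x, y) R) := by
      ext ⟨u, w⟩
      rw [h.mem_graph]
      simp only [hR, Set.mem_insert_iff, Prod.mk.injEq, Set.mem_ofPred_eq]
      grind
    have e1 : (h.update hy hxy hp).graph.edges = insert (par x, x) (insert (x, y) R) := by
      ext ⟨u, w⟩
      rw [IsParent.mem_graph]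
      simp only [hR, Set.mem_insert_iff, Prod.mk.injEq, Set.mem_ofPred_eq, Function.update_apply]
      grind
    have e2 : (h.update hx hxy.symm hp.symm).graph.edges =
        insert (par x, y) (insert (y, x) R) := by
      ext ⟨u, w⟩
      rw [IsParent.mem_graph]
      simp only [hR, Set.mem_insert_iff, Prod.mk.injEq, Set.mem_ofPred_eq, Function.update_apply]
      grind
    have hRo : ∀ u w, (u, w) ∈ R → (w, u) ∉ R := fun u w h3 h4 => by
      refine h.graph.oriented u w ?_ ?_
      · rw [e0]; exact .inr (.inr h3)
      · rw [e0]; exact .inr (.inr h4)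
    have n2 : (y, x) ∉ R := fun h' => h'.2.1 rfl
    have n3 : (x, par x) ∉ R := fun h' => h.graph.oriented (par x) x
      (by rw [e0]; simp) (by rw [e0]; exact .inr (.inr h'))
    have n6 : (par x, y) ∉ R := fun h' => h'.2.2.1 rfl
    clear_value R
    -- Arnold is applied to the cycle `par x → x → y → par x`. Omitting one of its edges leaves the
    -- chain with `y` below `x`, the chain with `x` below `y`, or the fork; the last two need
    -- reorienting.
    let G₂ := (h.update hx hxy.symm hp.symm).graph.reorient
      (insert (x, y) (insert (y, par x) R))
      (oriented_insert_insert hRo hxy hvy.symm hvx.symm n2 n6) (by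
        intro u w
        simp only [e2, Set.mem_insert_iff, Prod.mk.injEq]
        tauto)
    let G₃ := h.graph.reorient (insert (y, par x) (insert (par x, x) R))
      (oriented_insert_insert hRo hvy.symm hvx hxy.symm n6 n3) (by
        intro u w
        simp only [e0, Set.mem_insert_iff, Prod.mk.injEq]
        tauto)
    have harn := graphClass_arnold 𝕜 (G₁ := (h.update hy hxy hp).graph) (G₂ := G₂) (G₃ := G₃)
      (a := par x) (b := x) (c := y) (R := R) e1 rfl rfl
    have h2' : graphClass 𝕜 G₂ ∈ S :=
      graphClass_mem_of_toSimple_eq 𝕜 (SGraph.toSimple_reorient _ _ _ _) h2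
    refine graphClass_mem_of_toSimple_eq 𝕜 (G' := G₃) (SGraph.toSimple_reorient _ _ _ _).symm ?_
    rw [← neg_eq_of_add_eq_zero_right harn]
    exact S.neg_mem (S.add_mem h1 h2')

theorem span_longClass [NeZero n] (a : Fin n) :
    Submodule.span 𝕜
      (Set.range fun j : {j : Equiv.Perm (Fin n) // j 0 = a} => longClass 𝕜 j.1) = ⊤ := by
  rw [eq_top_iff]
  rintro x -
  obtain ⟨x, rfl⟩ := (arn 𝕜 n).mkQ_surjective x
  induction x using Finsupp.induction_linear with
  | zero => simp
  | add f g hf hg =>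
    rw [map_add]
    exact Submodule.add_mem _ hf hg
  | single G c =>
    rw [← mul_one c, ← smul_eq_mul, ← Finsupp.smul_single, map_smul]
    refine Submodule.smul_mem _ _ ?_
    obtain ⟨par, h, hG⟩ := IsParent.exists_of_sGraph G a
    refine graphClass_mem_of_toSimple_eq 𝕜 hG.symm (graphClass_isParent_mem 𝕜 ?_ h)
    exact fun σ h0 => Submodule.subset_span ⟨⟨σ, h0⟩, rfl⟩

/-! ### Coordinates with respect to long graphs, and the shuffle formula -/

theorem eq_sum_pairing_smul_longClass [NeZero n] (a : Fin n) (x : Eil 𝕜 n) :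
    x = ∑ σ : Equiv.Perm (Fin n) with σ 0 = a, pairing 𝕜 σ x • longClass 𝕜 σ := by
  have hx : x ∈ Submodule.span 𝕜
      (Set.range fun j : {j : Equiv.Perm (Fin n) // j 0 = a} => longClass 𝕜 j.1) := by
    rw [span_longClass]
    trivial
  induction hx using Submodule.span_induction with
  | mem x hx =>
    obtain ⟨⟨τ, hτ⟩, rfl⟩ := hx
    rw [Finset.sum_eq_single_of_mem τ (by simpa using hτ)]
    · rw [pairing_longClass_of_apply_zero_eq 𝕜 rfl, if_pos rfl, one_smul]
    · intro σ hσ hne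
      rw [pairing_longClass_of_apply_zero_eq 𝕜 (by simp_all), if_neg hne, zero_smul]
  | zero => simp
  | add x y _ _ hx hy =>
    nth_rewrite 1 [hx, hy]
    simp [add_smul, Finset.sum_add_distrib]
  | smul c x _ hx =>
    nth_rewrite 1 [hx]
    simp [mul_smul, Finset.smul_sum]

/-- After the substitution `σ = j * τ` only shuffles `τ` survive. The values `F` are arbitrary
because the same sum is needed for long graphs and for permuted tensors. -/
theorem sum_pairing_longClass_smul [NeZero n] {M : Type*} [AddCommGroup M] [Module 𝕜 M]
    (j : Equiv.Perm (Fin n)) (k : Fin n) (F : Equiv.Perm (Fin n) → M) :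
    ∑ σ : Equiv.Perm (Fin n) with σ 0 = j k, pairing 𝕜 σ (longClass 𝕜 j) • F σ =
      (-1 : ℤˣ) ^ k.val • ∑ τ ∈ shuffles k, F (j * τ) := by
  have h1 : ∑ σ : Equiv.Perm (Fin n) with σ 0 = j k, pairing 𝕜 σ (longClass 𝕜 j) • F σ =
      ∑ τ : Equiv.Perm (Fin n) with τ 0 = k, pairing 𝕜 (j * τ) (longClass 𝕜 j) • F (j * τ) := by
    symm
    refine Finset.sum_bij (fun τ _ => j * τ) ?_ ?_ ?_ ?_
    · simp +contextual
    · simp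
    · exact fun σ hσ => ⟨j⁻¹ * σ, by simp_all, by simp⟩
    · simp
  rw [h1, Finset.smul_sum]
  have hsub : shuffles k ⊆ Finset.univ.filter fun τ : Equiv.Perm (Fin n) => τ 0 = k := by
    intro τ hτ
    simpa using (mem_shuffles.mp hτ).1
  rw [← Finset.sum_subset hsub]
  · refine Finset.sum_congr rfl fun τ hτ => ?_
    rw [pairing_longClass, (mem_shuffles.mp hτ).1, if_pos hτ]
    rcases Nat.even_or_odd k.val with h | h <;> simp [h.neg_one_pow]
  · intro τ hτ hτ'
    have : τ 0 = k := by simpa using hτ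
    rw [pairing_longClass, this, if_neg hτ', zero_smul]

theorem longClass_eq_sum_shuffles [NeZero n] (j : Equiv.Perm (Fin n)) (k : Fin n) :
    longClass 𝕜 j = (-1 : ℤˣ) ^ k.val • ∑ τ ∈ shuffles k, longClass 𝕜 (j * τ) := by
  rw [← sum_pairing_longClass_smul 𝕜, ← eq_sum_pairing_smul_longClass]

end Graphs

/-! ### Koszul signs -/

section KoszulSign

variable {n : ℕ}

/-- The contribution of an unordered pair of positions to the Koszul sign. -/
def koszulPair (d : Fin n → ℤ) (τ : Equiv.Perm (Fin n)) : Sym2 (Fin n) → ℤˣ :=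
  Sym2.lift ⟨fun p q => if (p < q ∧ τ q < τ p) ∨ (q < p ∧ τ p < τ q) then
    (d (τ p) * d (τ q)).negOnePow else 1, fun p q => by
      dsimp only
      rw [mul_comm]
      exact if_congr or_comm rfl rfl⟩

theorem koszulPair_mk (d : Fin n → ℤ) (τ : Equiv.Perm (Fin n)) (p q : Fin n) :
    koszulPair d τ s(p, q) = if (p < q ∧ τ q < τ p) ∨ (q < p ∧ τ p < τ q) then
      (d (τ p) * d (τ q)).negOnePow else 1 := rfl

theorem koszulSign_eq_prod (d : Fin n → ℤ) (τ : Equiv.Perm (Fin n)) :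
    koszulSign d τ = ∏ z, koszulPair d τ z := by
  rw [← Sym2.sortEquiv.symm.prod_comp, koszulSign, Finset.prod_filter]
  symm
  have h : ∀ p : {p : Fin n × Fin n // p.1 ≤ p.2}, koszulPair d τ (Sym2.sortEquiv.symm p) =
      if p.1.1 < p.1.2 ∧ τ p.1.2 < τ p.1.1 then (d (τ p.1.1) * d (τ p.1.2)).negOnePow else 1 := by
    rintro ⟨⟨p, q⟩, hpq⟩
    change koszulPair d τ s(p, q) = _
    rw [koszulPair_mk]
    have : ¬ q < p := hpq.not_gt
    simp [this]
  rw [Finset.prod_congr rfl fun p _ => h p]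
  rw [← Finset.prod_subtype (Finset.univ.filter fun p : Fin n × Fin n => p.1 ≤ p.2) (by simp)
    (fun p => if p.1 < p.2 ∧ τ p.2 < τ p.1 then (d (τ p.1) * d (τ p.2)).negOnePow else 1)]
  refine Finset.prod_subset (Finset.filter_subset _ _) fun p _ hp => if_neg fun h => hp ?_
  simpa using h.1.le

/-- The check is made for each unordered pair of positions: a pair whose order is changed by both
permutations is restored by their product, and its two equal signs cancel. -/
theorem koszulSign_mul (d : Fin n → ℤ) (σ τ : Equiv.Perm (Fin n)) :
    koszulSign d (σ * τ) = koszulSign d σ * koszulSign (d ∘ σ) τ := by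
  simp only [koszulSign_eq_prod]
  rw [← (Finite.injective_iff_bijective.mp (Sym2.map.injective τ.injective)).prod_comp (koszulPair d σ),
    ← Finset.prod_mul_distrib]
  refine Finset.prod_congr rfl fun z _ => ?_
  induction z using Sym2.ind with
  | _ p q =>
  change koszulPair d (σ * τ) s(p, q) = koszulPair d σ s(τ p, τ q) * koszulPair (d ∘ σ) τ s(p, q)
  simp only [koszulPair_mk, Equiv.Perm.mul_apply, Function.comp_apply]
  rcases eq_or_ne p q with rfl | hpq
  · simp
  have h1 : τ p ≠ τ q := fun h => hpq (τ.injective h)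
  have h2 : σ (τ p) ≠ σ (τ q) := fun h => h1 (σ.injective h)
  rcases hpq.lt_or_gt with h | h <;> rcases h1.lt_or_gt with h' | h' <;>
    rcases h2.lt_or_gt with h'' | h'' <;>
    simp [h, h', h'', h.not_gt, h'.not_gt, h''.not_gt, Int.units_mul_self]

@[simp]
theorem koszulSign_one (d : Fin n → ℤ) : koszulSign d 1 = 1 := by
  refine Finset.prod_eq_one fun p hp => ?_
  obtain ⟨h1, h2⟩ := (Finset.mem_filter.mp hp).2
  exact absurd h2 h1.not_gt

end KoszulSign

/-! ### Homogeneous bases -/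

universe v

section Homogeneous

variable {𝕜 : Type*} [Field 𝕜] {W : Type*} [AddCommGroup W] [Module 𝕜 W]

theorem map_units_smul {M N : Type*} [AddCommGroup M] [AddCommGroup N] [Module 𝕜 M] [Module 𝕜 N]
    (f : M →ₗ[𝕜] N) (u : ℤˣ) (x : M) : f (u • x) = u • f x := by
  simp [Units.smul_def]

theorem units_smul_mem {M : Type*} [AddCommGroup M] [Module 𝕜 M] (S : Submodule 𝕜 M) (u : ℤˣ)
    {x : M} (hx : x ∈ S) : u • x ∈ S := by
  rw [Units.smul_def]
  exact zsmul_mem hx _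

theorem exists_homogeneous_basis {𝕜 : Type*} [Field 𝕜] {W : Type v} [AddCommGroup W]
    [Module 𝕜 W] (𝒲 : ℤ → Submodule 𝕜 W) [DirectSum.Decomposition 𝒲] :
    ∃ (ι : Type v) (b : Module.Basis ι 𝕜 W) (deg : ι → ℤ), ∀ i, b i ∈ 𝒲 (deg i) :=
  ⟨_, (DirectSum.Decomposition.isInternal 𝒲).collectedBasis
    fun d => Module.Basis.ofVectorSpace 𝕜 (𝒲 d), Sigma.fst,
    (DirectSum.Decomposition.isInternal 𝒲).collectedBasis_mem _⟩

/-- The projection to degree `d` keeps the basis vectors of degree `d` and kills the others. -/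
theorem mem_span_homogeneous_basis {𝒲 : ℤ → Submodule 𝕜 W} [DirectSum.Decomposition 𝒲]
    {ι : Type*} {b : Module.Basis ι 𝕜 W} {deg : ι → ℤ} (hb : ∀ i, b i ∈ 𝒲 (deg i))
    {d : ℤ} {w : W} (hw : w ∈ 𝒲 d) : w ∈ Submodule.span 𝕜 {x | ∃ i, deg i = d ∧ b i = x} := by
  have key : ∀ v : W, (DirectSum.decompose 𝒲 v d : W) ∈
      Submodule.span 𝕜 {x | ∃ i, deg i = d ∧ b i = x} := by
    intro v
    have hv : v ∈ Submodule.span 𝕜 (Set.range b) := b.mem_span v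
    induction hv using Submodule.span_induction with
    | mem v hv =>
      obtain ⟨i, rfl⟩ := hv
      by_cases hi : deg i = d
      · rw [← hi, DirectSum.decompose_of_mem_same 𝒲 (hb i), hi]
        exact Submodule.subset_span ⟨i, hi, rfl⟩
      · rw [DirectSum.decompose_of_mem_ne 𝒲 (hb i) hi]
        exact zero_mem _
    | zero => simp
    | add x y _ _ hx hy => simpa using add_mem hx hy
    | smul c x _ hx =>
      rw [DirectSum.decompose_smul]
      exact Submodule.smul_mem _ c hx
  simpa [DirectSum.decompose_of_mem_same 𝒲 hw] using key w

theorem _root_.MultilinearMap.eq_zero_of_mem_span {κ M : Type*} [Finite κ] [AddCommGroup M]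
    [Module 𝕜 M] (f : MultilinearMap 𝕜 (fun _ : κ => W) M) (s : κ → Set W)
    (h : ∀ w, (∀ i, w i ∈ s i) → f w = 0) (w : κ → W)
    (hw : ∀ i, w i ∈ Submodule.span 𝕜 (s i)) : f w = 0 := by
  classical
  have := Fintype.ofFinite κ
  suffices H : ∀ (t : Finset κ) (w : κ → W), (∀ i ∈ t, w i ∈ Submodule.span 𝕜 (s i)) →
      (∀ i ∉ t, w i ∈ s i) → f w = 0 from H Finset.univ w (fun i _ => hw i) (by simp)
  intro t
  induction t using Finset.induction_on with
  | empty => exact fun w _ h2 => h w fun i => h2 i (by simp)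
  | insert a t ha ih =>
    intro w h1 h2
    have key : ∀ x ∈ Submodule.span 𝕜 (s a), f (Function.update w a x) = 0 := by
      intro x hx
      induction hx using Submodule.span_induction with
      | mem x hx =>
        refine ih _ (fun i hi => ?_) fun i hi => ?_
        · rw [Function.update_of_ne (by rintro rfl; exact ha hi)]
          exact h1 i (Finset.mem_insert_of_mem hi)
        · rcases eq_or_ne i a with rfl | hia
          · rwa [Function.update_self]
          · rw [Function.update_of_ne hia]
            exact h2 i (by simp [hia, hi])
      | zero => exact f.map_coord_zero a (by simp)
      | add x y _ _ hx hy => rw [f.map_update_add, hx, hy, add_zero]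
      | smul c x _ hx => rw [f.map_update_smul, hx, smul_zero]
    have := key (w a) (h1 a (Finset.mem_insert_self _ _))
    rwa [Function.update_eq_self] at this

end Homogeneous

/-! ### The action of permutations on tensors -/

section Action

variable {𝕜 : Type*} [Field 𝕜] {W : Type*} [AddCommGroup W] [Module 𝕜 W] {n : ℕ}
  {ι : Type*} (b : Module.Basis ι 𝕜 W) (deg : ι → ℤ)

/-- The basis of `W^{⊗ n}` given by a basis of `W`. -/
def tensorBasis (n : ℕ) : Module.Basis (Fin n → ι) 𝕜 (⨂[𝕜] _ : Fin n, W) :=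
  Basis.piTensorProduct fun _ => b

theorem tensorBasis_apply (g : Fin n → ι) :
    tensorBasis b n g = PiTensorProduct.tprod 𝕜 (b ∘ g) := by
  simp [tensorBasis, Function.comp_def]

/-- The operator which permutes tensor factors with Koszul signs. -/
def permMap (σ : Equiv.Perm (Fin n)) : (⨂[𝕜] _ : Fin n, W) →ₗ[𝕜] ⨂[𝕜] _ : Fin n, W :=
  (tensorBasis b n).constr 𝕜 fun g =>
    koszulSign (deg ∘ g) σ • PiTensorProduct.tprod 𝕜 (b ∘ g ∘ σ)

theorem permMap_basis (σ : Equiv.Perm (Fin n)) (g : Fin n → ι) :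
    permMap b deg σ (PiTensorProduct.tprod 𝕜 (b ∘ g)) =
      koszulSign (deg ∘ g) σ • PiTensorProduct.tprod 𝕜 (b ∘ g ∘ σ) := by
  rw [← tensorBasis_apply, permMap, Module.Basis.constr_basis]

theorem permMap_tensorBasis (σ : Equiv.Perm (Fin n)) (g : Fin n → ι) :
    permMap b deg σ (tensorBasis b n g) = koszulSign (deg ∘ g) σ • tensorBasis b n (g ∘ σ) := by
  rw [tensorBasis_apply, permMap_basis, tensorBasis_apply]

/-- The operator is defined through a basis, yet obeys the Koszul rule on all homogeneous tensors:
each `w i` is a combination of basis vectors of its own degree, so the sign is constant in the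
multilinear expansion. -/
theorem permMap_tprod {𝒲 : ℤ → Submodule 𝕜 W} [DirectSum.Decomposition 𝒲]
    (hb : ∀ i, b i ∈ 𝒲 (deg i)) (σ : Equiv.Perm (Fin n)) {d : Fin n → ℤ} {w : Fin n → W}
    (hw : ∀ i, w i ∈ 𝒲 (d i)) :
    permMap b deg σ (PiTensorProduct.tprod 𝕜 w) =
      koszulSign d σ • PiTensorProduct.tprod 𝕜 (w ∘ σ) := by
  have := MultilinearMap.eq_zero_of_mem_span
    ((permMap b deg σ).compMultilinearMap (PiTensorProduct.tprod 𝕜) -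
      ((koszulSign d σ : ℤ) : 𝕜) • (PiTensorProduct.tprod 𝕜).domDomCongr σ)
    (fun i => {x | ∃ j, deg j = d i ∧ b j = x}) ?_ w
    (fun i => mem_span_homogeneous_basis hb (hw i))
  · simp only [sub_apply, LinearMap.compMultilinearMap_apply,
      smul_apply, MultilinearMap.domDomCongr_apply, sub_eq_zero] at this
    rw [this, Units.smul_def, Int.cast_smul_eq_zsmul]
    rfl
  · intro w hw
    choose g hg hgw using hw
    obtain rfl : b ∘ g = w := funext hgw
    obtain rfl : deg ∘ g = d := funext hg
    simp only [sub_apply, LinearMap.compMultilinearMap_apply,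
      smul_apply, MultilinearMap.domDomCongr_apply, sub_eq_zero]
    rw [permMap_basis, Units.smul_def, Int.cast_smul_eq_zsmul]
    rfl

theorem permMap_mul (σ τ : Equiv.Perm (Fin n)) (t : ⨂[𝕜] _ : Fin n, W) :
    permMap b deg (σ * τ) t = permMap b deg τ (permMap b deg σ t) := by
  have : permMap (n := n) b deg (σ * τ) = permMap b deg τ ∘ₗ permMap b deg σ := by
    refine (tensorBasis b n).ext fun g => ?_
    rw [LinearMap.comp_apply, tensorBasis_apply, permMap_basis, permMap_basis, map_units_smul,
      permMap_basis b deg τ (g ∘ σ), koszulSign_mul, mul_smul]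
    rfl
  rw [this, LinearMap.comp_apply]

theorem permMap_one (t : ⨂[𝕜] _ : Fin n, W) : permMap b deg 1 t = t := by
  have : permMap (n := n) b deg 1 = LinearMap.id := by
    refine (tensorBasis b n).ext fun g => ?_
    rw [tensorBasis_apply, permMap_basis]
    simp
  rw [this, LinearMap.id_apply]

/-- The linear map with `t ⊗ G ↦ treeCoeff σ G • σ t`. -/
def termMap (σ : Equiv.Perm (Fin n)) : LabelledGr 𝕜 W n →ₗ[𝕜] ⨂[𝕜] _ : Fin n, W :=
  permMap b deg σ ∘ₗ (TensorProduct.rid 𝕜 _).toLinearMap ∘ₗ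
    LinearMap.lTensor _ (grPairing 𝕜 σ)

theorem termMap_tmul (σ : Equiv.Perm (Fin n)) (t : ⨂[𝕜] _ : Fin n, W) (x : Gr 𝕜 n) :
    termMap b deg σ (t ⊗ₜ x) = pairing 𝕜 σ ((arn 𝕜 n).mkQ x) • permMap b deg σ t := by
  rw [pairing_mkQ]
  simp [termMap]

theorem termMap_arnRel (σ : Equiv.Perm (Fin n)) {x : LabelledGr 𝕜 W n} (hx : x ∈ arnRel 𝕜 W n) :
    termMap b deg σ x = 0 := by
  have : arnRel 𝕜 W n ≤ LinearMap.ker (termMap b deg σ) := by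
    refine Submodule.span_le.mpr ?_
    rintro _ ⟨g, hg, t, rfl⟩
    have : (arn 𝕜 n).mkQ g = 0 := (Submodule.Quotient.mk_eq_zero _).mpr hg
    simp only [SetLike.mem_coe, LinearMap.mem_ker, termMap_tmul, this, map_zero, zero_smul]
  exact this hx

theorem termMap_relabel (σ τ : Equiv.Perm (Fin n)) (t : ⨂[𝕜] _ : Fin n, W)
    (G : SGraph (Fin n)) :
    termMap b deg (τ * σ) (t ⊗ₜ Gr.of 𝕜 (G.relabel τ)) =
      termMap b deg σ (permMap b deg τ t ⊗ₜ Gr.of 𝕜 G) := by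
  simp only [termMap_tmul, pairing_mkQ, grPairing_of, treeCoeff_relabel, permMap_mul]

/-- Relabelling by `τ` carries the root `a` to `τ a`. The sum over one fixed root is thus not
invariant by itself, only up to a change of root. -/
theorem sum_termMap_relabel [NeZero n] (a : Fin n) (τ : Equiv.Perm (Fin n))
    (t : ⨂[𝕜] _ : Fin n, W) (G : SGraph (Fin n)) :
    ∑ σ : Equiv.Perm (Fin n) with σ 0 = τ a, termMap b deg σ (t ⊗ₜ Gr.of 𝕜 (G.relabel τ)) =
      ∑ σ : Equiv.Perm (Fin n) with σ 0 = a,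
        termMap b deg σ (permMap b deg τ t ⊗ₜ Gr.of 𝕜 G) := by
  symm
  refine Finset.sum_bij (fun σ _ => τ * σ) ?_ ?_ ?_ ?_
  · simp +contextual
  · simp
  · exact fun σ hσ => ⟨τ⁻¹ * σ, by simp_all, by simp⟩
  · intro σ _
    rw [termMap_relabel]

variable {b deg} {𝒲 : ℤ → Submodule 𝕜 W} [DirectSum.Decomposition 𝒲]

theorem symRel_le_ker (hb : ∀ i, b i ∈ 𝒲 (deg i)) {M : Type*} [AddCommGroup M] [Module 𝕜 M]
    (f : LabelledGr 𝕜 W n →ₗ[𝕜] M)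
    (hf : ∀ (t : ⨂[𝕜] _ : Fin n, W) (G : SGraph (Fin n)) (τ : Equiv.Perm (Fin n)),
      f (t ⊗ₜ Gr.of 𝕜 (G.relabel τ)) = f (permMap b deg τ t ⊗ₜ Gr.of 𝕜 G)) :
    symRel 𝕜 𝒲 n ≤ LinearMap.ker f := by
  refine Submodule.span_le.mpr ?_
  rintro _ ⟨G, τ, d, w, hw, rfl⟩
  rw [SetLike.mem_coe, LinearMap.mem_ker, map_sub, hf, permMap_tprod b deg hb τ hw, sub_eq_zero]
  simp only [Units.smul_def, TensorProduct.smul_tmul']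

/-- The map `𝔼ⁿ W → W^{⊗ n}` with `t ⊗ G ↦ ∑ σ, treeCoeff σ G • σ t`. -/
def symmetrize (hb : ∀ i, b i ∈ 𝒲 (deg i)) : E 𝕜 𝒲 n →ₗ[𝕜] ⨂[𝕜] _ : Fin n, W :=
  (symRel 𝕜 𝒲 n ⊔ arnRel 𝕜 W n).liftQ (∑ σ, termMap b deg σ) <| by
    refine sup_le (symRel_le_ker hb _ fun t G τ => ?_) fun x hx => ?_
    · rw [LinearMap.sum_apply, LinearMap.sum_apply,
        ← Equiv.sum_comp (Equiv.mulLeft τ)]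
      exact Finset.sum_congr rfl fun σ _ => termMap_relabel b deg σ τ t G
    · rw [LinearMap.mem_ker, LinearMap.sum_apply]
      exact Finset.sum_eq_zero fun σ _ => termMap_arnRel b deg σ hx

theorem symmetrize_bar [NeZero n] (hb : ∀ i, b i ∈ 𝒲 (deg i)) (w : Fin n → W) :
    symmetrize hb (bar 𝕜 𝒲 w) = ∑ σ, (treeCoeff σ (stdLong n).edges : 𝕜) •
      permMap b deg σ (PiTensorProduct.tprod 𝕜 w) := by
  simp only [symmetrize, bar, barMap, LinearMap.comp_apply, LinearMap.flip_apply,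
    TensorProduct.mk_apply, Submodule.mkQ_apply, Submodule.liftQ_apply, LinearMap.sum_apply]
  refine Finset.sum_congr rfl fun σ _ => ?_
  rw [termMap_tmul, pairing_mkQ, grPairing_of]

end Action

/-! ### Relations among bar generators -/

section Bar

variable {𝕜 : Type*} [Field 𝕜] {W : Type*} [AddCommGroup W] [Module 𝕜 W]
  (𝒲 : ℤ → Submodule 𝕜 W) {n : ℕ}

theorem longGraph_one [NeZero n] : longGraph (1 : Equiv.Perm (Fin n)) = stdLong n := rfl

/-- The map which labels the elements of `Eil(n)` by a tensor. -/
def labelMap (t : ⨂[𝕜] _ : Fin n, W) : Eil 𝕜 n →ₗ[𝕜] E 𝕜 𝒲 n :=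
  (arn 𝕜 n).liftQ ((symRel 𝕜 𝒲 n ⊔ arnRel 𝕜 W n).mkQ ∘ₗ TensorProduct.mk 𝕜 _ _ t) fun g hg =>
    (Submodule.Quotient.mk_eq_zero _).mpr
      (Submodule.mem_sup_right (Submodule.subset_span ⟨g, hg, t, rfl⟩))

theorem labelMap_mkQ (t : ⨂[𝕜] _ : Fin n, W) (x : Gr 𝕜 n) :
    labelMap 𝒲 t ((arn 𝕜 n).mkQ x) = (symRel 𝕜 𝒲 n ⊔ arnRel 𝕜 W n).mkQ (t ⊗ₜ x) := by
  rfl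

theorem labelMap_longClass_one [NeZero n] (t : ⨂[𝕜] _ : Fin n, W) :
    labelMap 𝒲 t (longClass 𝕜 1) = barMap 𝕜 𝒲 n t := by
  rw [longClass, labelMap_mkQ, longGraph_one]
  rfl

theorem labelMap_longClass [NeZero n] {d : Fin n → ℤ} {w : Fin n → W}
    (hw : ∀ i, w i ∈ 𝒲 (d i)) (τ : Equiv.Perm (Fin n)) :
    labelMap 𝒲 (PiTensorProduct.tprod 𝕜 w) (longClass 𝕜 τ) =
      koszulSign d τ • bar 𝕜 𝒲 (w ∘ τ) := by
  rw [longClass, labelMap_mkQ, bar, ← map_units_smul, barMap, LinearMap.comp_apply, ← sub_eq_zero,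
    ← map_sub]
  refine (Submodule.Quotient.mk_eq_zero _).mpr (Submodule.mem_sup_left (Submodule.subset_span ?_))
  refine ⟨stdLong n, τ, d, w, hw, ?_⟩
  rw [map_units_smul]
  rfl

theorem bar_eq_sum_shuffles [NeZero n] (k : Fin n) {d : Fin n → ℤ} {w : Fin n → W}
    (hw : ∀ i, w i ∈ 𝒲 (d i)) :
    bar 𝕜 𝒲 w = (-1 : ℤˣ) ^ k.val •
      ∑ τ ∈ shuffles k, koszulSign d τ • bar 𝕜 𝒲 (w ∘ τ) := by
  rw [bar, ← labelMap_longClass_one, longClass_eq_sum_shuffles 𝕜 1 k, map_units_smul, map_sum]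
  simp only [one_mul, labelMap_longClass 𝒲 hw]

theorem span_bar [DirectSum.Decomposition 𝒲] [NeZero n] :
    Submodule.span 𝕜 (Set.range (bar 𝕜 𝒲 (n := n))) = ⊤ := by
  obtain ⟨ι, b, deg, hb⟩ := exists_homogeneous_basis 𝒲
  rw [eq_top_iff]
  rintro x -
  obtain ⟨x, rfl⟩ := (symRel 𝕜 𝒲 n ⊔ arnRel 𝕜 W n).mkQ_surjective x
  induction x using TensorProduct.induction_on with
  | zero => simp
  | add x y hx hy =>
    rw [map_add]
    exact add_mem hx hy
  | tmul t x =>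
    rw [← labelMap_mkQ]
    generalize (arn 𝕜 n).mkQ x = x
    have hx : x ∈ Submodule.span 𝕜
        (Set.range fun j : {j : Equiv.Perm (Fin n) // j 0 = 0} => longClass 𝕜 j.1) := by
      rw [span_longClass]
      trivial
    induction hx using Submodule.span_induction with
    | mem x hx =>
      obtain ⟨τ, rfl⟩ := hx
      have e : ∀ t : ⨂[𝕜] _ : Fin n, W, labelMap 𝒲 t (longClass 𝕜 τ.1) =
          (symRel 𝕜 𝒲 n ⊔ arnRel 𝕜 W n).mkQ (t ⊗ₜ Gr.of 𝕜 (longGraph τ.1)) :=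
        fun t => labelMap_mkQ 𝒲 t _
      have ht := (tensorBasis b n).mem_span t
      induction ht using Submodule.span_induction with
      | mem t ht =>
        obtain ⟨g, rfl⟩ := ht
        dsimp only
        rw [tensorBasis_apply, labelMap_longClass 𝒲 (d := deg ∘ g) (w := b ∘ g) fun i => hb (g i)]
        exact units_smul_mem _ _ (Submodule.subset_span ⟨_, rfl⟩)
      | zero => rw [e, TensorProduct.zero_tmul, map_zero]; exact zero_mem _
      | add t u _ _ ht hu =>
        rw [e, TensorProduct.add_tmul, map_add, ← e, ← e]
        exact add_mem ht hu
      | smul c t _ ht =>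
        rw [e, ← TensorProduct.smul_tmul', map_smul, ← e]
        exact Submodule.smul_mem _ _ ht
    | zero => simp
    | add x y _ _ hx hy =>
      rw [map_add]
      exact add_mem hx hy
    | smul c x _ hx =>
      rw [map_smul]
      exact Submodule.smul_mem _ _ hx

/-- The span of the shuffle relators. -/
def shuffleSpan (n : ℕ) [NeZero n] : Submodule 𝕜 (⨂[𝕜] _ : Fin n, W) :=
  Submodule.span 𝕜 {x | ∃ (k : Fin n) (d : Fin n → ℤ) (w : Fin n → W),
    (∀ i, w i ∈ 𝒲 (d i)) ∧ x = shuffleRelator 𝕜 k d w}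

theorem shuffleSpan_le_ker [NeZero n] : shuffleSpan 𝒲 n ≤ LinearMap.ker (barMap 𝕜 𝒲 n) := by
  refine Submodule.span_le.mpr ?_
  rintro _ ⟨k, d, w, hw, rfl⟩
  have h := bar_eq_sum_shuffles 𝒲 k hw
  simp only [shuffleRelator, SetLike.mem_coe, LinearMap.mem_ker, map_add, map_units_smul, map_sum]
  simp only [bar] at h
  rw [h, pow_succ, mul_neg_one, Units.neg_smul, add_neg_cancel]

variable {𝒲} {ι : Type*} {b : Module.Basis ι 𝕜 W} {deg : ι → ℤ}

/-- The relators for basis vectors, extended by linearity to all tensors. -/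
theorem mkQ_sum_shuffles [NeZero n] (hb : ∀ i, b i ∈ 𝒲 (deg i)) (k : Fin n)
    (t : ⨂[𝕜] _ : Fin n, W) :
    (shuffleSpan 𝒲 n).mkQ ((-1 : ℤˣ) ^ k.val • ∑ τ ∈ shuffles k, permMap b deg τ t) =
      (shuffleSpan 𝒲 n).mkQ t := by
  have key : ((((-1 : ℤˣ) ^ k.val : ℤˣ) : ℤ) : 𝕜) • ((shuffleSpan 𝒲 n).mkQ ∘ₗ
      ∑ τ ∈ shuffles k, permMap b deg τ) = (shuffleSpan 𝒲 n).mkQ := by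
    refine (tensorBasis b n).ext fun g => ?_
    rw [LinearMap.smul_apply, LinearMap.comp_apply, LinearMap.sum_apply, Int.cast_smul_eq_zsmul,
      ← Units.smul_def, ← map_units_smul, eq_comm, ← sub_eq_zero, ← map_sub]
    refine (Submodule.Quotient.mk_eq_zero _).mpr (Submodule.subset_span ?_)
    refine ⟨k, deg ∘ g, b ∘ g, fun i => hb (g i), ?_⟩
    simp only [tensorBasis_apply, permMap_basis, shuffleRelator, pow_succ, mul_neg_one,
      Units.neg_smul, sub_eq_add_neg]
    rfl
  have := LinearMap.congr_fun key t
  rwa [LinearMap.smul_apply, LinearMap.comp_apply, LinearMap.sum_apply, Int.cast_smul_eq_zsmul,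
    ← Units.smul_def, ← map_units_smul] at this

theorem span_bar_first [NeZero n] (hb : ∀ i, b i ∈ 𝒲 (deg i)) (i₀ : ι) :
    Submodule.span 𝕜 (Set.range
        fun f : {f : Fin n → ι // ∀ j, f j = i₀ ↔ j = 0} => bar 𝕜 𝒲 (b ∘ f.1)) =
      Submodule.span 𝕜 (Set.range
        fun f : {f : Fin n → ι // ∃! j, f j = i₀} => bar 𝕜 𝒲 (b ∘ f.1)) := by
  refine le_antisymm (Submodule.span_mono ?_) (Submodule.span_le.mpr ?_)
  · rintro _ ⟨f, rfl⟩
    exact ⟨⟨f.1, 0, (f.2 0).mpr rfl, fun j hj => (f.2 j).mp hj⟩, rfl⟩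
  · rintro _ ⟨⟨f, k, hk, huniq⟩, rfl⟩
    simp only [SetLike.mem_coe]
    rw [bar_eq_sum_shuffles 𝒲 k (d := deg ∘ f) (w := b ∘ f) fun i => hb (f i)]
    refine units_smul_mem _ _ (Submodule.sum_mem _ fun τ hτ => units_smul_mem _ _ ?_)
    refine Submodule.subset_span ⟨⟨f ∘ τ, fun j => ?_⟩, rfl⟩
    have h0 := (mem_shuffles.mp hτ).1
    constructor
    · intro hj
      exact τ.injective ((huniq _ hj).trans h0.symm)
    · rintro rfl
      simpa [h0] using hk

/-- By linearity `x` may be a long graph `j`. With root `j k` the sum is the signed shuffle sum of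
the tensor permuted by `j`, hence congruent to that tensor, in which `k` no longer appears. -/
theorem mkQ_sum_pairing_smul [NeZero n] (hb : ∀ i, b i ∈ 𝒲 (deg i)) (a a' : Fin n)
    (t : ⨂[𝕜] _ : Fin n, W) (x : Eil 𝕜 n) :
    (shuffleSpan 𝒲 n).mkQ (∑ σ : Equiv.Perm (Fin n) with σ 0 = a,
      pairing 𝕜 σ x • permMap b deg σ t) =
    (shuffleSpan 𝒲 n).mkQ (∑ σ : Equiv.Perm (Fin n) with σ 0 = a',
      pairing 𝕜 σ x • permMap b deg σ t) := by
  have hx : x ∈ Submodule.span 𝕜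
      (Set.range fun j : {j : Equiv.Perm (Fin n) // j 0 = a} => longClass 𝕜 j.1) := by
    rw [span_longClass]
    trivial
  induction hx using Submodule.span_induction with
  | mem x hx =>
    obtain ⟨⟨j, -⟩, rfl⟩ := hx
    have key : ∀ k, (shuffleSpan 𝒲 n).mkQ (∑ σ : Equiv.Perm (Fin n) with σ 0 = j k,
        pairing 𝕜 σ (longClass 𝕜 j) • permMap b deg σ t) =
        (shuffleSpan 𝒲 n).mkQ (permMap b deg j t) := by
      intro k
      rw [sum_pairing_longClass_smul]
      simp only [permMap_mul]
      exact mkQ_sum_shuffles hb k _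
    have h1 := key (j.symm a)
    have h2 := key (j.symm a')
    rw [Equiv.apply_symm_apply] at h1 h2
    exact h1.trans h2.symm
  | zero => simp
  | add x y _ _ hx hy => simp only [map_add, add_smul, Finset.sum_add_distrib, hx, hy]
  | smul c x _ hx => simp only [map_smul, smul_eq_mul, mul_smul, ← Finset.smul_sum, hx]

/-! ### Completeness of the relations, and letters that occur once -/

variable [DirectSum.Decomposition 𝒲]

theorem ker_barMap [NeZero n] : LinearMap.ker (barMap 𝕜 𝒲 n) = shuffleSpan 𝒲 n := by
  refine le_antisymm ?_ (shuffleSpan_le_ker 𝒲)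
  obtain ⟨ι, b, deg, hb⟩ := exists_homogeneous_basis 𝒲
  -- This map descends to `𝔼ⁿ W` and gives a left inverse of the map induced by `barMap` on the
  -- quotient by the relators.
  let f : LabelledGr 𝕜 W n →ₗ[𝕜] (⨂[𝕜] _ : Fin n, W) ⧸ shuffleSpan 𝒲 n :=
    (shuffleSpan 𝒲 n).mkQ ∘ₗ ∑ σ : Equiv.Perm (Fin n) with σ 0 = 0, termMap b deg σ
  have hf : symRel 𝕜 𝒲 n ⊔ arnRel 𝕜 W n ≤ LinearMap.ker f := by
    refine sup_le (symRel_le_ker hb _ fun t G τ => ?_) fun x hx => ?_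
    · simp only [f, LinearMap.comp_apply, LinearMap.sum_apply]
      have h := sum_termMap_relabel b deg (τ.symm 0) τ t G
      rw [Equiv.apply_symm_apply] at h
      rw [h]
      simp only [termMap_tmul]
      exact mkQ_sum_pairing_smul hb _ _ _ _
    · simp only [f, LinearMap.mem_ker, LinearMap.comp_apply, LinearMap.sum_apply]
      rw [Finset.sum_eq_zero fun σ _ => termMap_arnRel b deg σ hx, map_zero]
  intro t ht
  have h0 : f (t ⊗ₜ Gr.of 𝕜 (stdLong n)) = 0 :=
    hf ((Submodule.Quotient.mk_eq_zero _).mp (LinearMap.mem_ker.mp ht))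
  -- On the standard long graph, with root `0`, only the identity contributes, so `f` returns the
  -- class of `t`.
  have h := sum_pairing_longClass_smul 𝕜 (1 : Equiv.Perm (Fin n)) 0 fun σ => permMap b deg σ t
  simp only [shuffles_zero, Finset.sum_singleton, mul_one, permMap_one, Fin.val_zero, pow_zero,
    one_smul, Equiv.Perm.coe_one, id_eq, longClass, longGraph_one] at h
  simp only [f, LinearMap.comp_apply, LinearMap.sum_apply, termMap_tmul] at h0
  refine (Submodule.Quotient.mk_eq_zero _).mp (.trans ?_ h0)
  nth_rewrite 1 [← h]
  congr!

theorem linearIndependent_bar [NeZero n] (hb : ∀ i, b i ∈ 𝒲 (deg i)) (i₀ : ι) :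
    LinearIndependent 𝕜
      (fun f : {f : Fin n → ι // ∀ j, f j = i₀ ↔ j = 0} => bar 𝕜 𝒲 (b ∘ f.1)) := by
  classical
  have key : ∀ f g : {f : Fin n → ι // ∀ j, f j = i₀ ↔ j = 0},
      (tensorBasis b n).repr (symmetrize hb (bar 𝕜 𝒲 (b ∘ f.1))) g.1 = if f = g then 1 else 0 := by
    intro f g
    rw [symmetrize_bar, ← tensorBasis_apply]
    simp only [permMap_tensorBasis, map_sum, map_smul, Units.smul_def, map_zsmul,
      Module.Basis.repr_self, Finsupp.finsetSum_apply, Finsupp.smul_apply]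
    -- If `σ` moves `0`, the permuted word no longer begins with `i₀` and differs from `g`; if `σ ≠
    -- 1` fixes `0`, its coefficient on the path vanishes.
    rw [Finset.sum_eq_single 1]
    · have := treeCoeff_stdLong (n := n) (k := 0) (σ := 1) rfl
      rw [this]
      simp [shuffles_zero, Finsupp.single_apply, Subtype.ext_iff]
    · intro σ _ hσ
      by_cases h0 : σ 0 = 0
      · have := treeCoeff_stdLong (n := n) (k := 0) h0
        rw [this]
        simp [shuffles_zero, hσ]
      · rw [Finsupp.single_apply, if_neg, smul_zero, smul_zero]
        intro h
        have h1 := congrFun h 0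
        rw [(g.2 0).mpr rfl] at h1
        exact h0 ((f.2 _).mp h1)
    · simp
  rw [linearIndependent_iff']
  intro s c hc i hi
  have := congrArg (fun x => (tensorBasis b n).repr (symmetrize hb x) i.1) hc
  simp only [map_sum, map_smul, Finsupp.finsetSum_apply, Finsupp.smul_apply, key, map_zero,
    Finsupp.zero_apply] at this
  simpa [hi] using this

end Bar

end LieCoalg

end

theorem mainTheorem9 {𝕜 : Type*} [Field 𝕜] {W : Type*} [AddCommGroup W] [Module 𝕜 W]
    (𝒲 : ℤ → Submodule 𝕜 W) [DirectSum.Decomposition 𝒲] (n : ℕ) [NeZero n] :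
    -- the bar generators span, and the shuffle relators span all relations among them
    Submodule.span 𝕜 (Set.range (LieCoalg.bar 𝕜 𝒲 (n := n))) = ⊤ ∧
    LinearMap.ker (LieCoalg.barMap 𝕜 𝒲 n) =
      Submodule.span 𝕜 {x | ∃ (k : Fin n) (d : Fin n → ℤ) (w : Fin n → W),
        (∀ i, w i ∈ 𝒲 (d i)) ∧ x = LieCoalg.shuffleRelator 𝕜 k d w} ∧
    -- each bar generator in terms of those beginning with its letter in position `k`
    (∀ (k : Fin n) (d : Fin n → ℤ) (w : Fin n → W), (∀ i, w i ∈ 𝒲 (d i)) →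
      LieCoalg.bar 𝕜 𝒲 w = (-1 : ℤˣ) ^ k.val •
        ∑ τ ∈ LieCoalg.shuffles k, LieCoalg.koszulSign d τ • LieCoalg.bar 𝕜 𝒲 (w ∘ τ)) ∧
    -- each long graph in `Eil(n)` in terms of those beginning with its vertex in position `k`
    (∀ (j : Equiv.Perm (Fin n)) (k : Fin n),
      LieCoalg.longClass 𝕜 j = (-1 : ℤˣ) ^ k.val •
        ∑ τ ∈ LieCoalg.shuffles k, LieCoalg.longClass 𝕜 (j * τ)) ∧
    -- the long graphs that begin with a given vertex are a basis of `Eil(n)`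
    (∀ a : Fin n,
      LinearIndependent 𝕜
        (fun j : {j : Equiv.Perm (Fin n) // j 0 = a} => LieCoalg.longClass 𝕜 j.1) ∧
      Submodule.span 𝕜
        (Set.range fun j : {j : Equiv.Perm (Fin n) // j 0 = a} => LieCoalg.longClass 𝕜 j.1) = ⊤) ∧
    -- for a homogeneous basis `b` of `W`, the bar generators in basis vectors in which `b i₀` occurs
    -- as the first letter and nowhere else are a basis of the span of all those in which it occurs
    -- exactly once
    (∀ {ι : Type*} (b : Module.Basis ι 𝕜 W) (deg : ι → ℤ), (∀ i, b i ∈ 𝒲 (deg i)) → ∀ i₀ : ι,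
      LinearIndependent 𝕜
        (fun f : {f : Fin n → ι // ∀ j, f j = i₀ ↔ j = 0} => LieCoalg.bar 𝕜 𝒲 (b ∘ f.1)) ∧
      Submodule.span 𝕜 (Set.range
        fun f : {f : Fin n → ι // ∀ j, f j = i₀ ↔ j = 0} => LieCoalg.bar 𝕜 𝒲 (b ∘ f.1)) =
      Submodule.span 𝕜 (Set.range
        fun f : {f : Fin n → ι // ∃! j, f j = i₀} => LieCoalg.bar 𝕜 𝒲 (b ∘ f.1))) := by
  refine ⟨LieCoalg.span_bar 𝒲, LieCoalg.ker_barMap,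
    fun k d w hw => LieCoalg.bar_eq_sum_shuffles 𝒲 k hw,
    LieCoalg.longClass_eq_sum_shuffles 𝕜,
    fun a => ⟨LieCoalg.linearIndependent_longClass 𝕜 a, LieCoalg.span_longClass 𝕜 a⟩,
    fun b deg hb i₀ => ⟨LieCoalg.linearIndependent_bar hb i₀, LieCoalg.span_bar_first hb i₀⟩⟩
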